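/- **Kelvin–Noether circulation theorem for the composition-of-maps wave–current model.** Let $\mathcal D\subseteq\mathbb R^2$ be open, let $a,b\in\mathbb R$, let $\sigma,Fr,\rho_{ref}>0$ be constants, and let $D_0,\rho_0:\mathcal D\to\mathbb R$ be smooth with $\rho_0>0$. Let $\phi_t:\mathcal D\to\mathcal D$ ($t\in(a,b)$) be smooth invertible maps (the horizontal current), let $\zeta_t:\mathcal D\to\mathbb R$ be the vertical elevation map, so that the parcel with label $\boldsymbol r_0$ is at horizontal position $\boldsymbol r_t=\phi_t(\boldsymbol r_0)$ and height $\zeta_t(\phi_t(\boldsymbol r_0))$, and let $p_t:\mathcal D\to\mathbb R$ be the pressure; $\phi_t,\phi_t^{-1},\zeta_t,p_t$ are smooth jointly in time and space. Define the horizontal velocity $\hat{\boldsymbol v}_t=\frac{d\phi_t}{dt}\circ\phi_t^{-1}$, the vertical velocity $\hat w$ by $\hat w_t(\phi_t(\boldsymbol r_0))=\frac{d}{dt}\big(\zeta_t(\phi_t(\boldsymbol r_0))\big)$, and the advected quantities $\rho_t=\rho_0\circ\phi_t^{-1}$ and $D_t\,d^2r=(\phi_t)_*(D_0\,d^2r_0)$,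 i.e. $D_t=(D_0\circ\phi_t^{-1})\det\nabla(\phi_t^{-1})$. Suppose that Hamilton's principle holds: the action $$S=\int_a^b\!\int_{\mathcal D}\bigg(\frac12\Big(|\hat{\boldsymbol v}|^2+\sigma^2\big(\partial_t\zeta+\nabla\zeta\cdot\hat{\boldsymbol v}\big)^2\Big)-\frac{\rho_{ref}}{\rho}\frac{\zeta^2}{2Fr^2}\bigg)D\rho-p\,(D-1)\;d^2r\,dt$$ is stationary, $\delta S=0$, under all smooth variations $(\phi^\varepsilon,\zeta^\varepsilon,p^\varepsilon)$ of $(\phi,\zeta,p)$ through smooth states of the above kind which differ from $(\phi,\zeta,p)$ only on a compact subset of $(a,b)\times\mathcal D$ (independent of small $\varepsilon$), where $\hat{\boldsymbol v},D,\rho$ vary along with $\phi$, with $D_0$ and $\rho_0$ fixed, and where $\delta S$ is the derivative at $\varepsilon=0$ of the integral of the increment of the integrand. Put $\tilde p:=p+\dfrac{\rho_{ref}\,\zeta^2}{2Fr^2}$. Then: 1. For every $C^1$ closed loop $c_0$ in $\mathcal D$, the loop $c_t=\phi_t(c_0)$ moving with the current satisfies, for all $t\in(a,b)$, $$\frac{d}{dt}\oint_{c_t}\big(\hat{\boldsymbol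 v}\cdot d\boldsymbol r+\sigma^2\hat w\,d\zeta\big)=-\oint_{c_t}\frac1\rho\,d\tilde p .$$ 2. On $(a,b)\times\mathcal D$ the material wave equations hold: $$(\partial_t+\hat{\boldsymbol v}\cdot\nabla)\hat w=-\frac{\rho_{ref}}{\sigma^2Fr^2\,\rho}\,\zeta,\qquad(\partial_t+\hat{\boldsymbol v}\cdot\nabla)\zeta=\hat w .$$ -/

import Mathlib

open Set MeasureTheory
open scoped ContDiff

namespace WaveCurrent

/-- The horizontal plane with its Euclidean inner product. -/
abbrev Plane : Type := EuclideanSpace ℝ (Fin 2)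

/-- The dynamical variables of the composition-of-maps model: the horizontal current map `φ t` from
labels to positions together with its inverse `ψ t` (positions to labels), the vertical elevation
map `ζ t` (a function of the horizontal position, so that the fluid parcel with label `r₀` is at
height `ζ t (φ t r₀)`), and the pressure `p t`, which is a Lagrange multiplier. -/
structure State where
  φ : ℝ → Plane → Plane
  ψ : ℝ → Plane → Plane
  ζ : ℝ → Plane → ℝ
  p : ℝ → Plane → ℝ

namespace State

/-- Smooth states on the time interval `J` and the horizontal domain `𝒟`: each `φ t` is a smooth
invertible map of `𝒟` onto itself with smooth inverse `ψ t`, and all variables are jointly smooth in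
time and space. -/
structure IsSmoothOn (u : State) (J : Set ℝ) (𝒟 : Set Plane) : Prop where
  mapsTo_φ : ∀ t ∈ J, MapsTo (u.φ t) 𝒟 𝒟
  mapsTo_ψ : ∀ t ∈ J, MapsTo (u.ψ t) 𝒟 𝒟
  leftInv : ∀ t ∈ J, LeftInvOn (u.ψ t) (u.φ t) 𝒟
  rightInv : ∀ t ∈ J, RightInvOn (u.ψ t) (u.φ t) 𝒟
  smooth_φ : ContDiffOn ℝ ∞ (fun q : ℝ × Plane => u.φ q.1 q.2) (J ×ˢ 𝒟)
  smooth_ψ : ContDiffOn ℝ ∞ (fun q : ℝ × Plane => u.ψ q.1 q.2) (J ×ˢ 𝒟)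
  smooth_ζ : ContDiffOn ℝ ∞ (fun q : ℝ × Plane => u.ζ q.1 q.2) (J ×ˢ 𝒟)
  smooth_p : ContDiffOn ℝ ∞ (fun q : ℝ × Plane => u.p q.1 q.2) (J ×ˢ 𝒟)

/-- The Eulerian horizontal velocity `v̂ₜ = (dφₜ/dt) ∘ φₜ⁻¹` of the current. -/
noncomputable def velocity (u : State) (t : ℝ) (x : Plane) : Plane :=
  deriv (fun s => u.φ s (u.ψ t x)) t

/-- The material derivative `(∂ₜ + v̂ · ∇) f` of a scalar field `f`. -/
noncomputable def materialDeriv (u : State) (f : ℝ → Plane → ℝ) (t : ℝ) (x : Plane) : ℝ :=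
  deriv (fun s => f s x) t + fderiv ℝ (f t) x (u.velocity t x)

/-- The Eulerian vertical velocity `ŵ`, determined by `ŵₜ(φₜ r₀) = d/dt (ζₜ(φₜ r₀))`. -/
noncomputable def verticalVelocity (u : State) (t : ℝ) (x : Plane) : ℝ :=
  deriv (fun s => u.ζ s (u.φ s (u.ψ t x))) t

/-- The mass density with label profile `ρ₀`, advected as a scalar: `ρₜ = ρ₀ ∘ φₜ⁻¹`. -/
noncomputable def density (u : State) (ρ₀ : Plane → ℝ) (t : ℝ) (x : Plane) : ℝ :=
  ρ₀ (u.ψ t x)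

/-- The areal density with label profile `D₀`, advected as a 2-form:
`Dₜ d²r = (φₜ)₊ (D₀ d²r₀)`, that is, `Dₜ = (D₀ ∘ φₜ⁻¹) det (∇ φₜ⁻¹)`. -/
noncomputable def areaDensity (u : State) (D₀ : Plane → ℝ) (t : ℝ) (x : Plane) : ℝ :=
  D₀ (u.ψ t x) * (fderiv ℝ (u.ψ t) x).det

/-- The space-time density of the action of the wave-current model. -/
noncomputable def lagrangianDensity (u : State) (σ Fr ρref : ℝ) (D₀ ρ₀ : Plane → ℝ)
    (t : ℝ) (x : Plane) : ℝ :=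
  (1 / 2 * (‖u.velocity t x‖ ^ 2
        + σ ^ 2 * (deriv (fun s => u.ζ s x) t + fderiv ℝ (u.ζ t) x (u.velocity t x)) ^ 2)
      - ρref / u.density ρ₀ t x * (u.ζ t x ^ 2 / (2 * Fr ^ 2)))
    * (u.areaDensity D₀ t x * u.density ρ₀ t x)
  - u.p t x * (u.areaDensity D₀ t x - 1)

/-- Smooth variations of `u`: one-parameter families `U ε`, smooth jointly in `ε`, time and space,
through smooth states, which pass through `u` at `ε = 0` and, for small `ε`, differ from `u` only on
a compact subset of `J ×ˢ 𝒟` (on which `φ` is a function of time and label, while `ζ` and `p` are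
functions of time and position). In particular they vanish near the end points of the time
interval `J`. The inverse current map `ψ` and the advected densities vary along with `φ`. -/
def IsVariation (u : State) (J : Set ℝ) (𝒟 : Set Plane) (U : ℝ → State) : Prop :=
  U 0 = u ∧ ∃ δ : ℝ, 0 < δ ∧
    (∀ ε ∈ Ioo (-δ) δ, (U ε).IsSmoothOn J 𝒟) ∧
    ContDiffOn ℝ ∞ (fun q : ℝ × ℝ × Plane => (U q.1).φ q.2.1 q.2.2) (Ioo (-δ) δ ×ˢ J ×ˢ 𝒟) ∧
    ContDiffOn ℝ ∞ (fun q : ℝ × ℝ × Plane => (U q.1).ψ q.2.1 q.2.2) (Ioo (-δ) δ ×ˢ J ×ˢ 𝒟) ∧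
    ContDiffOn ℝ ∞ (fun q : ℝ × ℝ × Plane => (U q.1).ζ q.2.1 q.2.2) (Ioo (-δ) δ ×ˢ J ×ˢ 𝒟) ∧
    ContDiffOn ℝ ∞ (fun q : ℝ × ℝ × Plane => (U q.1).p q.2.1 q.2.2) (Ioo (-δ) δ ×ˢ J ×ˢ 𝒟) ∧
    ∃ K : Set (ℝ × Plane), IsCompact K ∧ K ⊆ J ×ˢ 𝒟 ∧
      ∀ ε ∈ Ioo (-δ) δ, ∀ t ∈ J, ∀ x ∈ 𝒟, (t, x) ∉ K →
        (U ε).φ t x = u.φ t x ∧ (U ε).ζ t x = u.ζ t x ∧ (U ε).p t x = u.p t x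

/-- The increment `S(u') - S(u)` of the action on the time interval `(a, b)`. It is written as the
integral of the increment of the density, so that it makes sense for compactly supported
perturbations also where the domain is unbounded and the action itself is infinite. -/
noncomputable def actionIncrement (σ Fr ρref a b : ℝ) (𝒟 : Set Plane) (D₀ ρ₀ : Plane → ℝ)
    (u u' : State) : ℝ :=
  ∫ q in Ioo a b ×ˢ 𝒟, (u'.lagrangianDensity σ Fr ρref D₀ ρ₀ q.1 q.2
    - u.lagrangianDensity σ Fr ρref D₀ ρ₀ q.1 q.2)

/-- Hamilton's principle `δS = 0`: the action is stationary at `u` under all smooth variations of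
the current map, of the elevation map and of the pressure. -/
def HamiltonPrinciple (σ Fr ρref a b : ℝ) (𝒟 : Set Plane) (D₀ ρ₀ : Plane → ℝ)
    (u : State) : Prop :=
  ∀ U : ℝ → State, u.IsVariation (Ioo a b) 𝒟 U →
    HasDerivAt (fun ε => actionIncrement σ Fr ρref a b 𝒟 D₀ ρ₀ u (U ε)) 0 0

/-- The 1-form `v̂ · dr + σ² ŵ dζ` at time `t`. -/
noncomputable def momentumForm (u : State) (σ : ℝ) (t : ℝ) (x : Plane) : Plane →L[ℝ] ℝ :=
  innerSL ℝ (u.velocity t x) + (σ ^ 2 * u.verticalVelocity t x) • fderiv ℝ (u.ζ t) x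

/-- The modified pressure `p̃ = p + ρ_ref ζ² / (2 Fr²)`. -/
noncomputable def modifiedPressure (u : State) (Fr ρref : ℝ) (t : ℝ) (x : Plane) : ℝ :=
  u.p t x + ρref * u.ζ t x ^ 2 / (2 * Fr ^ 2)

/-- The 1-form `(1/ρ) dp̃` at time `t`. -/
noncomputable def pressureForm (u : State) (Fr ρref : ℝ) (ρ₀ : Plane → ℝ) (t : ℝ) (x : Plane) :
    Plane →L[ℝ] ℝ :=
  (1 / u.density ρ₀ t x) • fderiv ℝ (u.modifiedPressure Fr ρref t) x

/-- The closed loops `γ t` are the images under the current map of one closed loop `c` of labels,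
that is, `γ` is a loop that moves with the current during `J`. -/
def IsMaterialLoop (u : State) (J : Set ℝ) {y : Plane} (c : Path y y) {r : ℝ → Plane}
    (γ : ∀ t, Path (r t) (r t)) : Prop :=
  ∀ t ∈ J, ∀ s, γ t s = u.φ t (c s)

end State

end WaveCurrent

/-! Two explicit families of variations already give all the equations of motion. With the current
fixed, replace `ζ` by `ζ + εαχ` and `p` by `p + εβχ`. With the current varied, deform the position
space by the shear `x ↦ x + εχ(t,x)e` and let it carry `ζ` and `p` along. Then each parcel keeps its
height, vertical velocity, density and pressure; only `v̂` and the areal density change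
(`lagrangianDensity_push`). In both cases the action increment is exactly a quadratic polynomial in
`ε`, so stationarity kills its linear coefficient (`eq_zero_of_hasDerivAt_quadratic`) and no
derivative is taken under an integral.

Write `d/dt` for the material derivative. The pressure variation gives `D = 1`, hence `det ∇φₜ = D₀`
at each label, independently of `t`. In label coordinates `d/dt` is a plain time derivative and the
Jacobian does not depend on time, so `d/dt` of a test function integrates to zero
(`integral_flowDeriv_eq_zero`). This integration by parts, the constancy of `ρ` along trajectories
and the fundamental lemma give `σ²ρ dŵ/dt = -ρref ζ/Fr²` and `ρ dv̂/dt = -∇p`. The former is the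
dynamical wave equation; the kinematic one is the chain rule.

For the circulation, pull everything back to the fixed loop of labels. With `V = ∂ₜφ`, `Z = ζ ∘ φ`
and `W = ∂ₜZ`, the momentum form becomes `V·dφ + σ²W dZ`. Symmetry of second derivatives shows that
its time derivative is `∂ₜV·dφ + σ²∂ₜW dZ` plus the differential of the kinetic energy
(`fderiv_labelMomentumForm`). The equations of motion turn the former into `-(1/ρ)dp̃`, and the
exact term integrates to zero around the loop. -/

namespace WaveCurrent

open Filter Topology

/-! ### Compactly supported functions: smooth extension by zero and integrals of derivatives -/

section Analysis

variable {E F : Type*} [NormedAddCommGroup E] [NormedSpace ℝ E]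
  [NormedAddCommGroup F] [NormedSpace ℝ F]

/-- A function that is smooth on an open set and vanishes off a closed subset of it is smooth. -/
theorem contDiff_of_eqOn_zero {n : WithTop ℕ∞} {f : E → F} {Q T : Set E} (hQ : IsOpen Q)
    (hT : IsClosed T) (hTQ : T ⊆ Q) (hf : ContDiffOn ℝ n f Q) (h0 : ∀ q ∉ T, f q = 0) :
    ContDiff ℝ n f := by
  rw [contDiff_iff_contDiffAt]
  intro q
  by_cases hq : q ∈ T
  · exact hf.contDiffAt (hQ.mem_nhds (hTQ hq))
  · have : f =ᶠ[𝓝 q] fun _ => 0 := by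
      filter_upwards [hT.isOpen_compl.mem_nhds hq] with z hz using h0 z hz
    exact contDiffAt_const.congr_of_eventuallyEq this

variable [FiniteDimensional ℝ E] [MeasurableSpace E] [BorelSpace E]

/-- The integral of a directional derivative of a compactly supported function vanishes. -/
theorem integral_fderiv_apply_eq_zero {μ : Measure E} [μ.IsAddHaarMeasure] {k : E → ℝ}
    (hk : ContDiff ℝ 1 k) (hc : HasCompactSupport k) (w : E) :
    ∫ q, fderiv ℝ k q w ∂μ = 0 := by
  have hint : Integrable (fun q => fderiv ℝ k q w) μ := by
    refine Continuous.integrable_of_hasCompactSupport ?_ ?_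
    · exact (hk.continuous_fderiv (by norm_num)).clm_apply continuous_const
    · exact hc.fderiv_apply ℝ w
  -- Integration by parts against the constant function 1.
  have h := integral_mul_fderiv_eq_neg_fderiv_mul_of_integrable (μ := μ) (v := w)
    (f := fun _ : E => (1 : ℝ)) (g := k) (by simp) (by simpa using hint)
    (by simpa using hk.continuous.integrable_of_hasCompactSupport hc)
    (fun _ _ => by fun_prop) (fun q _ => hk.differentiable (by norm_num) q)
  simpa using h

end Analysis

/-! ### Compactly supported shears and their inverses -/

section Shear

/-- A contractive perturbation of the identity is bijective. -/
theorem bijective_of_lipschitz {E : Type*} [NormedAddCommGroup E] [CompleteSpace E] {g : E → E} {K : NNReal} (hK : K < 1)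
    (hg : LipschitzWith K g) : Function.Bijective (fun q => q + g q) := by
  constructor
  · intro x y hxy
    have h1 : x - y = g y - g x := by
      have : x + g x = y + g y := hxy
      rw [sub_eq_sub_iff_add_eq_add, this, add_comm]
    have h2 := hg.dist_le_mul y x
    rw [dist_eq_norm, dist_eq_norm, ← h1, norm_sub_rev y x] at h2
    have h3 : (K : ℝ) < 1 := by exact_mod_cast hK
    have h4 : ‖x - y‖ = 0 := by nlinarith [norm_nonneg (x - y)]
    exact sub_eq_zero.1 (norm_eq_zero.1 h4)
  · intro z
    -- A preimage of `z` under `q ↦ q + g q` is a fixed point of the contraction `q ↦ z - g q`.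
    have hc : ContractingWith K (fun q => z - g q) := by
      refine ⟨hK, LipschitzWith.of_dist_le_mul fun x y => ?_⟩
      rw [dist_sub_left]
      exact hg.dist_le_mul x y
    refine ⟨hc.fixedPoint, ?_⟩
    have := hc.fixedPoint_isFixedPt
    have h : z - g hc.fixedPoint = hc.fixedPoint := this
    show hc.fixedPoint + g hc.fixedPoint = z
    nth_rewrite 1 [← h]
    simp

variable {E : Type*} [NormedAddCommGroup E] [NormedSpace ℝ E]

/-- The map that moves each point `q` by `ε χ(q)` in the direction `v`. -/
def shear (χ : E → ℝ) (v : E) (ε : ℝ) (q : E) : E := q + (ε * χ q) • v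

/-- The inverse of `shear χ v ε` where there is one. -/
noncomputable def shearInv (χ : E → ℝ) (v : E) (ε : ℝ) : E → E := Function.invFun (shear χ v ε)

theorem shear_zero (χ : E → ℝ) (v : E) : shear χ v 0 = id := by
  funext q; simp [shear]

theorem shearInv_zero (χ : E → ℝ) (v : E) : shearInv χ v 0 = id := by
  funext q
  have := Function.leftInverse_invFun (f := shear χ v 0) (by
    rw [shear_zero]; exact Function.injective_id) q
  rw [shear_zero] at this
  rw [shearInv, shear_zero]
  exact this

theorem shear_of_eq_zero {χ : E → ℝ} {v : E} {ε : ℝ} {q : E} (h : χ q = 0) :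
    shear χ v ε q = q := by simp [shear, h]

theorem contDiff_shear {χ : E → ℝ} (hχ : ContDiff ℝ ∞ χ) (v : E) :
    ContDiff ℝ ∞ (fun z : ℝ × E => shear χ v z.1 z.2) := by
  unfold shear
  have := hχ.comp (contDiff_snd (𝕜 := ℝ) (E := ℝ) (F := E))
  exact contDiff_snd.add ((contDiff_fst.mul this).smul contDiff_const)

theorem hasFDerivAt_shear {χ : E → ℝ} (hχ : ContDiff ℝ ∞ χ) (v : E) (ε : ℝ) (q : E) :
    HasFDerivAt (shear χ v ε)
      (ContinuousLinearMap.id ℝ E + (ε • fderiv ℝ χ q).smulRight v) q := by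
  have h : HasFDerivAt χ (fderiv ℝ χ q) q :=
    ((hχ.differentiable (by simp)) q).hasFDerivAt
  exact (hasFDerivAt_id q).add ((h.const_mul ε).smul_const v)

/-- The identity plus a rank-one map is a transvection in the general sense, whose determinant is
known. -/
theorem det_id_add_smulRight [FiniteDimensional ℝ E] (f : E →L[ℝ] ℝ) (v : E) :
    (ContinuousLinearMap.id ℝ E + f.smulRight v).det = 1 + f v := by
  rw [← ContinuousLinearMap.coe_coe f, ← LinearMap.transvection.det]
  rfl

/-- Compact support makes `χ` globally Lipschitz, with constant `C` say. The single bound `|ε| C ‖v‖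
< 1` makes the displacement a contraction and keeps the Jacobian positive at every point. -/
theorem exists_bijective_shear [FiniteDimensional ℝ E] {χ : E → ℝ} (hχ : ContDiff ℝ ∞ χ)
    (hc : HasCompactSupport χ) (v : E) :
    ∃ δ : ℝ, 0 < δ ∧ ∀ ε ∈ Ioo (-δ) δ, Function.Bijective (shear χ v ε) ∧
      ∀ q, 0 < 1 + ε * fderiv ℝ χ q v := by
  have := FiniteDimensional.complete ℝ E
  obtain ⟨C, hC⟩ := (hχ.of_le (by simp) : ContDiff ℝ 1 χ).lipschitzWith_of_hasCompactSupport
    hc (by norm_num)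
  have hpos : 0 < (C : ℝ) * ‖v‖ + 1 := by positivity
  -- The summand 1 keeps the radius meaningful when `C * ‖v‖ = 0`.
  refine ⟨1 / (C * ‖v‖ + 1), by positivity, fun ε hε => ?_⟩
  have hε' : |ε| * (C * ‖v‖) < 1 := by
    have h1 : |ε| < 1 / (C * ‖v‖ + 1) := abs_lt.2 hε
    rw [lt_div_iff₀ hpos] at h1
    nlinarith [abs_nonneg ε]
  constructor
  · refine bijective_of_lipschitz (K := ⟨|ε| * (C * ‖v‖), by positivity⟩)
      (g := fun q => (ε * χ q) • v) (by exact_mod_cast hε') ?_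
    refine LipschitzWith.of_dist_le_mul fun x y => ?_
    have h := hC.dist_le_mul x y
    rw [dist_eq_norm, ← sub_smul, norm_smul, ← mul_sub, norm_mul, Real.norm_eq_abs,
      ← dist_eq_norm]
    calc |ε| * dist (χ x) (χ y) * ‖v‖ ≤ |ε| * (C * dist x y) * ‖v‖ := by gcongr
      _ = (|ε| * (C * ‖v‖)) * dist x y := by ring
  · intro q
    have h1 : ‖fderiv ℝ χ q v‖ ≤ C * ‖v‖ :=
      (ContinuousLinearMap.le_opNorm _ _).trans
        (mul_le_mul_of_nonneg_right (norm_fderiv_le_of_lipschitz ℝ hC) (norm_nonneg v))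
    have h2 : |ε * fderiv ℝ χ q v| < 1 := by
      rw [abs_mul]
      exact (mul_le_mul_of_nonneg_left h1 (abs_nonneg ε)).trans_lt hε'
    linarith [(abs_lt.1 h2).1]

/-- The inverse of a shear is smooth jointly in the parameter and the point. -/
theorem contDiffOn_shearInv [FiniteDimensional ℝ E] {χ : E → ℝ} (hχ : ContDiff ℝ ∞ χ) {v : E}
    {δ : ℝ} (hδ : ∀ ε ∈ Ioo (-δ) δ, Function.Bijective (shear χ v ε) ∧
      ∀ q, 0 < 1 + ε * fderiv ℝ χ q v) :
    ContDiffOn ℝ ∞ (fun z : ℝ × E => shearInv χ v z.1 z.2) (Ioo (-δ) δ ×ˢ univ) := by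
  have := FiniteDimensional.complete ℝ E
  rintro ⟨ε, q⟩ ⟨hε, -⟩
  apply ContDiffAt.contDiffWithinAt
  set p : E := shearInv χ v ε q with hp
  have hpq : shear χ v ε p = q := Function.rightInverse_invFun (hδ ε hε).1.2 q
  let θ : ℝ × E → ℝ := fun z => z.1 * χ z.2
  -- With the parameter as an extra coordinate that stays fixed, the whole family is one map `H`.
  -- The inverse function theorem for `H` then yields smoothness jointly in `ε` and `q`.
  let H : ℝ × E → ℝ × E := fun z => z + θ z • ((0 : ℝ), v)
  have hH : ∀ z, H z = (z.1, shear χ v z.1 z.2) := by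
    intro z; ext <;> simp [H, θ, shear]
  have hθ : ContDiff ℝ ∞ θ := contDiff_fst.mul (hχ.comp contDiff_snd)
  have hHs : ContDiff ℝ ∞ H := contDiff_id.add (hθ.smul contDiff_const)
  have hd : HasFDerivAt H (ContinuousLinearMap.id ℝ (ℝ × E)
      + (fderiv ℝ θ (ε, p)).smulRight ((0 : ℝ), v)) (ε, p) :=
    (hasFDerivAt_id _).add (((hθ.differentiable (by simp)) _).hasFDerivAt.smul_const _)
  have hθv : fderiv ℝ θ (ε, p) ((0 : ℝ), v) = ε * fderiv ℝ χ p v := by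
    have h1 : HasFDerivAt (fun z : ℝ × E => χ z.2)
        ((fderiv ℝ χ p).comp (ContinuousLinearMap.snd ℝ ℝ E)) (ε, p) :=
      HasFDerivAt.comp (ε, p) (((hχ.differentiable (by simp)) p).hasFDerivAt) hasFDerivAt_snd
    have h2 := (hasFDerivAt_fst (𝕜 := ℝ) (p := (ε, p))).mul h1
    have h3 : HasFDerivAt θ _ (ε, p) := h2
    rw [h3.fderiv]
    simp
  have hdet : (ContinuousLinearMap.id ℝ (ℝ × E)
      + (fderiv ℝ θ (ε, p)).smulRight ((0 : ℝ), v)).det ≠ 0 := by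
    rw [det_id_add_smulRight, hθv]
    exact ((hδ ε hε).2 p).ne'
  let A := ContinuousLinearMap.toContinuousLinearEquivOfDetNeZero _ hdet
  have hA : HasFDerivAt H (A : ℝ × E →L[ℝ] ℝ × E) (ε, p) := by
    rw [ContinuousLinearMap.coe_toContinuousLinearEquivOfDetNeZero]; exact hd
  have hHa : ContDiffAt ℝ ∞ H (ε, p) := hHs.contDiffAt
  have hstr : HasStrictFDerivAt H (A : ℝ × E →L[ℝ] ℝ × E) (ε, p) :=
    hHa.hasStrictFDerivAt' hA (by simp)
  have hloc : ContDiffAt ℝ ∞ (hHa.localInverse hA (by simp)) (H (ε, p)) :=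
    hHa.to_localInverse hA (by simp)
  have hHp : H (ε, p) = (ε, q) := by rw [hH]; simp [hpq]
  rw [hHp] at hloc
  have hval : hHa.localInverse hA (by simp) (ε, q) = (ε, p) := by
    rw [← hHp]; exact hHa.localInverse_apply_image hA (by simp)
  have hev := hstr.eventually_right_inverse
  rw [hHp] at hev
  -- Near `(ε, q)` the local inverse of `H` agrees with `shearInv`, because each shear in the
  -- parameter range is injective.
  refine (contDiffAt_snd.comp _ hloc).congr_of_eventuallyEq ?_
  have hε1 : ∀ᶠ z : ℝ × E in 𝓝 (ε, q), z.1 ∈ Ioo (-δ) δ :=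
    continuous_fst.continuousAt.eventually (isOpen_Ioo.mem_nhds hε)
  filter_upwards [hev, hε1] with z hz hz1
  have hz' : H (hHa.localInverse hA (by simp) z) = z := hz
  set y := hHa.localInverse hA (by simp) z
  rw [hH] at hz'
  show shearInv χ v z.1 z.2 = y.2
  rw [← hz'] at hz1 ⊢
  exact Function.leftInverse_invFun (hδ _ hz1).1.1 y.2

end Shear

/-! ### Partial derivatives in time and space -/

section Slices

variable {G F : Type*} [NormedAddCommGroup G] [NormedSpace ℝ G]
  [NormedAddCommGroup F] [NormedSpace ℝ F] {f : ℝ × G → F} {t : ℝ} {x : G}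

theorem hasDerivAt_slice_time (hf : DifferentiableAt ℝ f (t, x)) :
    HasDerivAt (fun s => f (s, x)) (fderiv ℝ f (t, x) (1, 0)) t :=
  hf.hasFDerivAt.comp_hasDerivAt t ((hasDerivAt_id t).prodMk (hasDerivAt_const t x))

theorem hasFDerivAt_slice_space (hf : DifferentiableAt ℝ f (t, x)) :
    HasFDerivAt (fun y => f (t, y)) ((fderiv ℝ f (t, x)).comp (.inr ℝ ℝ G)) x :=
  hf.hasFDerivAt.comp x (hasFDerivAt_prodMk_right t x)

theorem hasDerivAt_along_curve {g : ℝ → G} {v : G} (hf : DifferentiableAt ℝ f (t, g t))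
    (hg : HasDerivAt g v t) : HasDerivAt (fun s => f (s, g s)) (fderiv ℝ f (t, g t) (1, v)) t :=
  hf.hasFDerivAt.comp_hasDerivAt t ((hasDerivAt_id t).prodMk hg)

theorem fderiv_apply_eq_add (f' : ℝ × G →L[ℝ] F) (v : G) :
    f' (1, v) = f' (1, 0) + f' (0, v) := by
  rw [← map_add]; simp

theorem contDiffOn_fderiv_apply {E : Type*} [NormedAddCommGroup E] [NormedSpace ℝ E] {f : E → F}
    {Q : Set E} (hQ : IsOpen Q) (hf : ContDiffOn ℝ ∞ f Q) {w : E → E}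
    (hw : ContDiffOn ℝ ∞ w Q) : ContDiffOn ℝ ∞ (fun q => fderiv ℝ f q (w q)) Q :=
  (hf.fderiv_of_isOpen hQ (by simp)).clm_apply hw

theorem differentiableAt_of_contDiffOn {E : Type*} [NormedAddCommGroup E] [NormedSpace ℝ E]
    {f : E → F} {Q : Set E} (hQ : IsOpen Q) (hf : ContDiffOn ℝ ∞ f Q) {q : E} (hq : q ∈ Q) :
    DifferentiableAt ℝ f q :=
  (hf.contDiffAt (hQ.mem_nhds hq)).differentiableAt (by simp)

end Slices

/-! ### Kinematics of the current in space-time -/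

namespace State

variable {u : State} {J : Set ℝ} {𝒟 : Set Plane}

/-- The map `(t, y) ↦ (t, φ t y)` from labels to positions in space-time. -/
def toPos (u : State) (q : ℝ × Plane) : ℝ × Plane := (q.1, u.φ q.1 q.2)

/-- The map `(t, x) ↦ (t, ψ t x)` from positions to labels in space-time. -/
def toLabel (u : State) (q : ℝ × Plane) : ℝ × Plane := (q.1, u.ψ q.1 q.2)

/-- The derivative along the space-time velocity `(1, v̂)`. -/
noncomputable def flowDeriv {F : Type*} [NormedAddCommGroup F] [NormedSpace ℝ F] (u : State)
    (f : ℝ × Plane → F) (q : ℝ × Plane) : F := fderiv ℝ f q (1, u.velocity q.1 q.2)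

/-- The velocity of the current as a function of time and label. -/
noncomputable def labelVelocity (u : State) (q : ℝ × Plane) : Plane :=
  fderiv ℝ (fun q : ℝ × Plane => u.φ q.1 q.2) q (1, 0)

theorem materialDeriv_eq {f : ℝ → Plane → ℝ} {q : ℝ × Plane}
    (hf : DifferentiableAt ℝ (fun q : ℝ × Plane => f q.1 q.2) q) :
    u.materialDeriv f q.1 q.2 = u.flowDeriv (fun q : ℝ × Plane => f q.1 q.2) q := by
  rw [materialDeriv, (hasDerivAt_slice_time (t := q.1) (x := q.2) hf).deriv,
    (hasFDerivAt_slice_space (t := q.1) (x := q.2) hf).fderiv, flowDeriv, fderiv_apply_eq_add _ (u.velocity q.1 q.2)]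
  rfl

namespace IsSmoothOn

variable (hu : u.IsSmoothOn J 𝒟)
include hu

theorem mapsTo_toPos : MapsTo u.toPos (J ×ˢ 𝒟) (J ×ˢ 𝒟) :=
  fun q hq => ⟨hq.1, hu.mapsTo_φ q.1 hq.1 hq.2⟩

theorem mapsTo_toLabel : MapsTo u.toLabel (J ×ˢ 𝒟) (J ×ˢ 𝒟) :=
  fun q hq => ⟨hq.1, hu.mapsTo_ψ q.1 hq.1 hq.2⟩

theorem toPos_toLabel {q : ℝ × Plane} (hq : q ∈ J ×ˢ 𝒟) : u.toPos (u.toLabel q) = q :=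
  Prod.ext rfl (hu.rightInv q.1 hq.1 hq.2)

theorem toLabel_toPos {q : ℝ × Plane} (hq : q ∈ J ×ˢ 𝒟) : u.toLabel (u.toPos q) = q :=
  Prod.ext rfl (hu.leftInv q.1 hq.1 hq.2)

theorem contDiffOn_toPos : ContDiffOn ℝ ∞ u.toPos (J ×ˢ 𝒟) :=
  contDiffOn_fst.prodMk hu.smooth_φ

theorem contDiffOn_toLabel : ContDiffOn ℝ ∞ u.toLabel (J ×ˢ 𝒟) :=
  contDiffOn_fst.prodMk hu.smooth_ψ

theorem injOn_toPos : InjOn u.toPos (J ×ˢ 𝒟) := fun p hp q hq h => by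
  rw [← hu.toLabel_toPos hp, h, hu.toLabel_toPos hq]

theorem image_toPos : u.toPos '' (J ×ˢ 𝒟) = J ×ˢ 𝒟 :=
  Subset.antisymm hu.mapsTo_toPos.image_subset
    fun q hq => ⟨u.toLabel q, hu.mapsTo_toLabel hq, hu.toPos_toLabel hq⟩

variable (hJ : IsOpen J) (h𝒟 : IsOpen 𝒟)
include hJ h𝒟

theorem hasDerivAt_φ {q : ℝ × Plane} (hq : q ∈ J ×ˢ 𝒟) :
    HasDerivAt (fun s => u.φ s q.2) (u.labelVelocity q) q.1 :=
  hasDerivAt_slice_time (differentiableAt_of_contDiffOn (hJ.prod h𝒟) hu.smooth_φ hq)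

theorem contDiffOn_labelVelocity : ContDiffOn ℝ ∞ u.labelVelocity (J ×ˢ 𝒟) :=
  contDiffOn_fderiv_apply (hJ.prod h𝒟) hu.smooth_φ contDiffOn_const

theorem velocity_eq {q : ℝ × Plane} (hq : q ∈ J ×ˢ 𝒟) :
    u.velocity q.1 q.2 = u.labelVelocity (u.toLabel q) :=
  (hu.hasDerivAt_φ hJ h𝒟 (hu.mapsTo_toLabel hq)).deriv

theorem velocity_toPos {q : ℝ × Plane} (hq : q ∈ J ×ˢ 𝒟) :
    u.velocity q.1 (u.φ q.1 q.2) = u.labelVelocity q :=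
  (hu.velocity_eq hJ h𝒟 (hu.mapsTo_toPos hq)).trans (by rw [hu.toLabel_toPos hq])

theorem contDiffOn_velocity :
    ContDiffOn ℝ ∞ (fun q : ℝ × Plane => u.velocity q.1 q.2) (J ×ˢ 𝒟) :=
  ((hu.contDiffOn_labelVelocity hJ h𝒟).comp hu.contDiffOn_toLabel hu.mapsTo_toLabel).congr
    fun _ hq => hu.velocity_eq hJ h𝒟 hq

theorem contDiffOn_flowDeriv {F : Type*} [NormedAddCommGroup F] [NormedSpace ℝ F]
    {f : ℝ × Plane → F} (hf : ContDiffOn ℝ ∞ f (J ×ˢ 𝒟)) :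
    ContDiffOn ℝ ∞ (u.flowDeriv f) (J ×ˢ 𝒟) :=
  contDiffOn_fderiv_apply (hJ.prod h𝒟) hf (contDiffOn_const.prodMk (hu.contDiffOn_velocity hJ h𝒟))

/-- The material derivative is the time derivative along the trajectories of the current. -/
theorem hasDerivAt_along_flow {F : Type*} [NormedAddCommGroup F] [NormedSpace ℝ F]
    {f : ℝ × Plane → F} {q : ℝ × Plane} (hq : q ∈ J ×ˢ 𝒟)
    (hf : DifferentiableAt ℝ f (u.toPos q)) :
    HasDerivAt (fun s => f (s, u.φ s q.2)) (u.flowDeriv f (u.toPos q)) q.1 := by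
  have h := hasDerivAt_along_curve (g := fun s => u.φ s q.2) hf (hu.hasDerivAt_φ hJ h𝒟 hq)
  rw [← hu.velocity_toPos hJ h𝒟 hq] at h
  exact h

theorem fderiv_comp_toPos {F : Type*} [NormedAddCommGroup F] [NormedSpace ℝ F]
    {f : ℝ × Plane → F} {q : ℝ × Plane} (hq : q ∈ J ×ˢ 𝒟)
    (hf : DifferentiableAt ℝ f (u.toPos q)) :
    fderiv ℝ (fun p => f (u.toPos p)) q (1, 0) = u.flowDeriv f (u.toPos q) := by
  have h1 : DifferentiableAt ℝ u.toPos q :=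
    differentiableAt_of_contDiffOn (hJ.prod h𝒟) hu.contDiffOn_toPos hq
  exact (hasDerivAt_slice_time (t := q.1) (x := q.2) (hf.comp q h1)).unique
    (hu.hasDerivAt_along_flow hJ h𝒟 hq hf)

theorem verticalVelocity_eq {q : ℝ × Plane} (hq : q ∈ J ×ˢ 𝒟) :
    u.verticalVelocity q.1 q.2 = u.flowDeriv (fun q : ℝ × Plane => u.ζ q.1 q.2) q := by
  have h := hu.hasDerivAt_along_flow hJ h𝒟 (hu.mapsTo_toLabel hq)
    (f := fun q : ℝ × Plane => u.ζ q.1 q.2)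
  rw [hu.toPos_toLabel hq] at h
  exact (h (differentiableAt_of_contDiffOn (hJ.prod h𝒟) hu.smooth_ζ hq)).deriv

theorem materialDeriv_ζ {q : ℝ × Plane} (hq : q ∈ J ×ˢ 𝒟) :
    u.materialDeriv u.ζ q.1 q.2 = u.verticalVelocity q.1 q.2 := by
  rw [hu.verticalVelocity_eq hJ h𝒟 hq,
    materialDeriv_eq (differentiableAt_of_contDiffOn (hJ.prod h𝒟) hu.smooth_ζ hq)]

theorem contDiffOn_verticalVelocity :
    ContDiffOn ℝ ∞ (fun q : ℝ × Plane => u.verticalVelocity q.1 q.2) (J ×ˢ 𝒟) :=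
  (hu.contDiffOn_flowDeriv hJ h𝒟 hu.smooth_ζ).congr fun _ hq => hu.verticalVelocity_eq hJ h𝒟 hq

omit hJ h𝒟 in
theorem contDiffOn_density {ρ₀ : Plane → ℝ} (hρ₀ : ContDiffOn ℝ ∞ ρ₀ 𝒟) :
    ContDiffOn ℝ ∞ (fun q : ℝ × Plane => u.density ρ₀ q.1 q.2) (J ×ˢ 𝒟) :=
  hρ₀.comp hu.smooth_ψ fun _ hq => (hu.mapsTo_toLabel hq).2

/-- The mass density is constant along trajectories. -/
theorem flowDeriv_density {ρ₀ : Plane → ℝ} (hρ₀ : ContDiffOn ℝ ∞ ρ₀ 𝒟) {q : ℝ × Plane}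
    (hq : q ∈ J ×ˢ 𝒟) : u.flowDeriv (fun q : ℝ × Plane => u.density ρ₀ q.1 q.2) q = 0 := by
  have h := hu.hasDerivAt_along_flow hJ h𝒟 (hu.mapsTo_toLabel hq)
    (f := fun q : ℝ × Plane => u.density ρ₀ q.1 q.2)
  rw [hu.toPos_toLabel hq] at h
  refine (h (differentiableAt_of_contDiffOn (hJ.prod h𝒟) (hu.contDiffOn_density hρ₀) hq)).unique ?_
  -- Along the trajectory of the label `ψ t x` the density is the value of `ρ₀` at that label, for
  -- all times in `J`.
  have hc := hasDerivAt_const q.1 (ρ₀ (u.ψ q.1 q.2))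
  refine hc.congr_of_eventuallyEq ?_
  filter_upwards [hJ.mem_nhds hq.1] with s hs
  simp only [density]
  have := hu.leftInv s hs (hu.mapsTo_toLabel hq).2
  exact congrArg ρ₀ this

theorem hasFDerivAt_ψ {q : ℝ × Plane} (hq : q ∈ J ×ˢ 𝒟) :
    HasFDerivAt (u.ψ q.1)
      ((fderiv ℝ (fun q : ℝ × Plane => u.ψ q.1 q.2) q).comp (.inr ℝ ℝ Plane)) q.2 :=
  hasFDerivAt_slice_space (t := q.1) (x := q.2)
    (differentiableAt_of_contDiffOn (hJ.prod h𝒟) hu.smooth_ψ hq)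

theorem hasFDerivAt_φ {q : ℝ × Plane} (hq : q ∈ J ×ˢ 𝒟) :
    HasFDerivAt (u.φ q.1)
      ((fderiv ℝ (fun q : ℝ × Plane => u.φ q.1 q.2) q).comp (.inr ℝ ℝ Plane)) q.2 :=
  hasFDerivAt_slice_space (t := q.1) (x := q.2)
    (differentiableAt_of_contDiffOn (hJ.prod h𝒟) hu.smooth_φ hq)

theorem continuousOn_areaDensity {D₀ : Plane → ℝ} (hD₀ : ContDiffOn ℝ ∞ D₀ 𝒟) :
    ContinuousOn (fun q : ℝ × Plane => u.areaDensity D₀ q.1 q.2) (J ×ˢ 𝒟) := by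
  have h1 : ContinuousOn (fun q : ℝ × Plane =>
      ((fderiv ℝ (fun q : ℝ × Plane => u.ψ q.1 q.2) q).comp (.inr ℝ ℝ Plane)).det) (J ×ˢ 𝒟) :=
    ContinuousLinearMap.continuous_det.comp_continuousOn
      ((hu.smooth_ψ.continuousOn_fderiv_of_isOpen (hJ.prod h𝒟) (by simp)).clm_comp
        continuousOn_const)
  refine ((hD₀.continuousOn.comp hu.smooth_ψ.continuousOn
    fun _ hq => (hu.mapsTo_toLabel hq).2).mul h1).congr fun q hq => ?_
  simp only [areaDensity, (hu.hasFDerivAt_ψ hJ h𝒟 hq).fderiv]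
  rfl

theorem det_fderiv_φ_mul_det_fderiv_ψ {q : ℝ × Plane} (hq : q ∈ J ×ˢ 𝒟) :
    (fderiv ℝ (u.ψ q.1) (u.φ q.1 q.2)).det * (fderiv ℝ (u.φ q.1) q.2).det = 1 := by
  have h1 := (hu.hasFDerivAt_φ hJ h𝒟 hq).differentiableAt.hasFDerivAt
  have h2 := (hu.hasFDerivAt_ψ hJ h𝒟 (hu.mapsTo_toPos hq)).differentiableAt.hasFDerivAt
  have h3 := h2.comp q.2 h1
  have h4 : HasFDerivAt (u.ψ q.1 ∘ u.φ q.1) (.id ℝ Plane) q.2 := by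
    refine (hasFDerivAt_id q.2).congr_of_eventuallyEq ?_
    filter_upwards [h𝒟.mem_nhds hq.2] with y hy using hu.leftInv q.1 hq.1 hy
  have h5 := congrArg ContinuousLinearMap.det (h3.unique h4)
  simpa [ContinuousLinearMap.det, LinearMap.det_comp, toPos] using h5

end IsSmoothOn

end State

/-! ### Test functions, integration by parts and the fundamental lemma -/

section TestFunctions

variable {E : Type*} [NormedAddCommGroup E] [NormedSpace ℝ E] {Q : Set E}

/-- Smooth functions with compact support in `Q`. -/
structure IsTest (χ : E → ℝ) (Q : Set E) : Prop where
  smooth : ContDiff ℝ ∞ χ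
  compact : HasCompactSupport χ
  subset : tsupport χ ⊆ Q

namespace IsTest

variable {χ : E → ℝ}

theorem fderiv_eq_zero {q : E} (hq : q ∉ tsupport χ) : fderiv ℝ χ q = 0 :=
  fderiv_of_notMem_tsupport ℝ hq

variable (hχ : IsTest χ Q)
include hχ

theorem differentiable : Differentiable ℝ χ := hχ.smooth.differentiable (by simp)

/-- Coefficients such as `v̂` or `ρ` are controlled only on `Q` and may take arbitrary values
elsewhere. Vanishing off the support of `χ` makes the products globally smooth all the same. -/
theorem of_eq_zero (hQ : IsOpen Q) {k : E → ℝ} (hk : ContDiffOn ℝ ∞ k Q)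
    (h0 : ∀ q ∉ tsupport χ, k q = 0) : IsTest k Q where
  smooth := contDiff_of_eqOn_zero hQ (isClosed_tsupport χ) hχ.subset hk h0
  compact := HasCompactSupport.intro hχ.compact h0
  subset := (closure_minimal (Function.support_subset_iff'.2 h0)
    (isClosed_tsupport χ)).trans hχ.subset

theorem mul_left (hQ : IsOpen Q) {f : E → ℝ} (hf : ContDiffOn ℝ ∞ f Q) :
    IsTest (fun q => f q * χ q) Q :=
  hχ.of_eq_zero hQ (hf.mul hχ.smooth.contDiffOn) fun q hq => by rw [image_eq_zero_of_notMem_tsupport hq, mul_zero]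

theorem fderiv_apply (hQ : IsOpen Q) {w : E → E} (hw : ContDiffOn ℝ ∞ w Q) :
    IsTest (fun q => fderiv ℝ χ q (w q)) Q :=
  hχ.of_eq_zero hQ (contDiffOn_fderiv_apply hQ hχ.smooth.contDiffOn hw) fun q hq => by
    rw [fderiv_eq_zero hq]; rfl

theorem integrable [MeasurableSpace E] [OpensMeasurableSpace E] (μ : Measure E)
    [IsFiniteMeasureOnCompacts μ] : Integrable χ μ :=
  hχ.smooth.continuous.integrable_of_hasCompactSupport hχ.compact

/-- Integration by parts along a vector field whose derivatives of test functions integrate to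
zero. -/
theorem integral_mul_fderiv_apply [MeasurableSpace E] [OpensMeasurableSpace E] {μ : Measure E}
    [IsFiniteMeasureOnCompacts μ] (hQ : IsOpen Q) {w : E → E} (hw : ContDiffOn ℝ ∞ w Q)
    (h0 : ∀ k : E → ℝ, IsTest k Q → ∫ q, fderiv ℝ k q (w q) ∂μ = 0) {f : E → ℝ}
    (hf : ContDiffOn ℝ ∞ f Q) :
    ∫ q, f q * fderiv ℝ χ q (w q) ∂μ = - ∫ q, fderiv ℝ f q (w q) * χ q ∂μ := by
  have h1 := ((hχ.fderiv_apply hQ hw).mul_left hQ hf).integrable μ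
  have h2 := (hχ.mul_left hQ (contDiffOn_fderiv_apply hQ hf hw)).integrable μ
  -- The sum of the two integrands is the derivative of the test function `f χ` along `w`.
  rw [← add_eq_zero_iff_eq_neg, ← integral_add h1 h2, ← h0 _ (hχ.mul_left hQ hf)]
  refine integral_congr_ae (ae_of_all _ fun q => ?_)
  by_cases hq : q ∈ tsupport χ
  · have hd := (differentiableAt_of_contDiffOn hQ hf (hχ.subset hq)).hasFDerivAt.mul
      (hχ.differentiable q).hasFDerivAt
    have hd' : HasFDerivAt (fun q => f q * χ q) _ q := hd
    simp [hd'.fderiv]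
    ring
  -- Here `f` need not be differentiable, but `f χ` vanishes in a neighbourhood of `q`.
  · have h3 : q ∉ tsupport fun q => f q * χ q := fun h => hq <|
      closure_mono (Function.support_mul_subset_right f χ) h
    simp [fderiv_eq_zero hq, fderiv_eq_zero h3, image_eq_zero_of_notMem_tsupport hq]

end IsTest

/-- The fundamental lemma of the calculus of variations. -/
theorem eq_zero_of_forall_integral_eq_zero [FiniteDimensional ℝ E] [MeasurableSpace E]
    [BorelSpace E] {μ : Measure E} [μ.IsAddHaarMeasure] (hQ : IsOpen Q) {f : E → ℝ}
    (hf : ContinuousOn f Q) (h : ∀ χ, IsTest χ Q → ∫ q, f q * χ q ∂μ = 0) :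
    ∀ q ∈ Q, f q = 0 := by
  have h1 := hQ.ae_eq_zero_of_integral_contDiff_smul_eq_zero (μ := μ) (f := f)
    (hf.locallyIntegrableOn hQ.measurableSet) fun g hg hc hs => by
      rw [← h g ⟨hg, hc, hs⟩]
      simp [mul_comm]
  have h2 : f =ᵐ[μ.restrict Q] fun _ => 0 := (ae_restrict_iff' hQ.measurableSet).2 h1
  exact fun q hq => Measure.eqOn_open_of_ae_eq h2 hQ hf continuousOn_const hq

end TestFunctions

/-! ### Change of variables to labels and weak incompressibility -/

theorem det_fst_prod {G : Type*} [NormedAddCommGroup G] [NormedSpace ℝ G] [FiniteDimensional ℝ G]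
    (f : ℝ × G →L[ℝ] G) :
    ((ContinuousLinearMap.fst ℝ ℝ G).prod f).det = (f.comp (.inr ℝ ℝ G)).det := by
  -- The block triangular map factors as `T` after a block diagonal map; `T` is a transvection of
  -- determinant 1 carrying the off-diagonal block `f (1, 0)`.
  let T : ℝ × G →L[ℝ] ℝ × G := ContinuousLinearMap.id ℝ (ℝ × G)
    + (ContinuousLinearMap.fst ℝ ℝ G).smulRight ((0 : ℝ), f (1, 0))
  let B : G →ₗ[ℝ] G := (f.comp (.inr ℝ ℝ G) : G →L[ℝ] G)
  have hT : T.det = 1 := by simp [T, det_id_add_smulRight]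
  have h : (((ContinuousLinearMap.fst ℝ ℝ G).prod f : ℝ × G →L[ℝ] ℝ × G) :
      ℝ × G →ₗ[ℝ] ℝ × G) = (T : ℝ × G →ₗ[ℝ] ℝ × G) ∘ₗ LinearMap.prodMap LinearMap.id B := by
    refine LinearMap.ext fun z => Prod.ext (by simp [T]) ?_
    have hz : z = z.1 • ((1 : ℝ), (0 : G)) + ((0 : ℝ), z.2) := by ext <;> simp
    simp only [ContinuousLinearMap.coe_coe, ContinuousLinearMap.prod_apply]
    conv_lhs => rw [hz, map_add, map_smul]
    simp [T, B, add_comm]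
  rw [ContinuousLinearMap.det, h, LinearMap.det_comp, LinearMap.det_prodMap]
  have hT' : LinearMap.det (T : ℝ × G →ₗ[ℝ] ℝ × G) = 1 := hT
  rw [hT', LinearMap.det_id, one_mul, one_mul]

instance isAddHaarMeasure_volume_prod : (volume : Measure (ℝ × Plane)).IsAddHaarMeasure :=
  inferInstanceAs ((volume : Measure ℝ).prod (volume : Measure Plane)).IsAddHaarMeasure

namespace State.IsSmoothOn

variable {u : State} {J : Set ℝ} {𝒟 : Set Plane} (hu : u.IsSmoothOn J 𝒟) (hJ : IsOpen J)
  (h𝒟 : IsOpen 𝒟)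
include hu hJ h𝒟

theorem hasFDerivAt_toPos {q : ℝ × Plane} (hq : q ∈ J ×ˢ 𝒟) :
    HasFDerivAt u.toPos ((ContinuousLinearMap.fst ℝ ℝ Plane).prod
      (fderiv ℝ (fun q : ℝ × Plane => u.φ q.1 q.2) q)) q :=
  hasFDerivAt_fst.prodMk
    (differentiableAt_of_contDiffOn (hJ.prod h𝒟) hu.smooth_φ hq).hasFDerivAt

variable {D₀ : Plane → ℝ} (hD : ∀ q ∈ J ×ˢ 𝒟, u.areaDensity D₀ q.1 q.2 = 1)
include hD

/-- At the image point `D = 1` reads `D₀ · det ∇ψ = 1`, while `det ∇ψ · det ∇φ = 1`. The point is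
that the resulting Jacobian does not depend on time. -/
theorem det_fderiv_toPos {q : ℝ × Plane} (hq : q ∈ J ×ˢ 𝒟) :
    ((ContinuousLinearMap.fst ℝ ℝ Plane).prod
      (fderiv ℝ (fun q : ℝ × Plane => u.φ q.1 q.2) q)).det = D₀ q.2 := by
  have h1 := hD _ (hu.mapsTo_toPos hq)
  have h2 := hu.det_fderiv_φ_mul_det_fderiv_ψ hJ h𝒟 hq
  have h3 : u.ψ q.1 (u.φ q.1 q.2) = q.2 := hu.leftInv q.1 hq.1 hq.2
  simp only [areaDensity, toPos, h3] at h1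
  rw [det_fst_prod, ← (hu.hasFDerivAt_φ hJ h𝒟 hq).fderiv]
  calc _ = D₀ q.2 * ((fderiv ℝ (u.ψ q.1) (u.φ q.1 q.2)).det * (fderiv ℝ (u.φ q.1) q.2).det) := by
        rw [← mul_assoc, h1, one_mul]
    _ = _ := by rw [h2, mul_one]

/-- A weak form of the incompressibility of the current. -/
theorem integral_flowDeriv_eq_zero (hD₀ : ContDiffOn ℝ ∞ D₀ 𝒟) {k : ℝ × Plane → ℝ}
    (hk : IsTest k (J ×ˢ 𝒟)) : ∫ q, u.flowDeriv k q = 0 := by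
  have hQ := hJ.prod h𝒟
  -- `D₀` may be negative, where the current reverses orientation, so the Jacobian weight is `|D₀|`;
  -- it is smooth because `D₀` never vanishes.
  have hD₀ne : ∀ q ∈ J ×ˢ 𝒟, D₀ q.2 ≠ 0 := fun q hq h => by
    have h1 := hD _ (hu.mapsTo_toPos hq)
    have h3 : u.ψ q.1 (u.φ q.1 q.2) = q.2 := hu.leftInv q.1 hq.1 hq.2
    simp [areaDensity, toPos, h3, h] at h1
  let f : ℝ × Plane → ℝ := fun q => |D₀ q.2| * k (u.toPos q)
  -- `F` is `k` in label coordinates times the Jacobian weight. The weight is constant in time, so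
  -- `∂ₜF` is exactly the integrand produced by the change of variables. The indicator removes the
  -- uncontrolled values of `φ` outside the domain.
  let F : ℝ × Plane → ℝ := (J ×ˢ 𝒟).indicator f
  have hf : ContDiffOn ℝ ∞ f (J ×ˢ 𝒟) := by
    refine ContDiffOn.mul ?_ (hk.smooth.comp_contDiffOn hu.contDiffOn_toPos)
    exact (hD₀.comp contDiffOn_snd fun q hq => hq.2).abs hD₀ne
  have hFf : EqOn F f (J ×ˢ 𝒟) := fun q hq => indicator_of_mem hq f
  have hT : IsCompact (u.toLabel '' tsupport k) :=
    hk.compact.isCompact.image_of_continuousOn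
      (hu.contDiffOn_toLabel.continuousOn.mono hk.subset)
  have hTQ : u.toLabel '' tsupport k ⊆ J ×ˢ 𝒟 :=
    (hu.mapsTo_toLabel.mono_left hk.subset).image_subset
  have hF0 : ∀ q ∉ u.toLabel '' tsupport k, F q = 0 := fun q hq => by
    by_cases h : q ∈ J ×ˢ 𝒟
    · rw [hFf h]
      have : u.toPos q ∉ tsupport k := fun h' => hq ⟨_, h', hu.toLabel_toPos h⟩
      simp [f, image_eq_zero_of_notMem_tsupport this]
    · exact indicator_of_notMem h f
  have hFs : ContDiff ℝ ∞ F := contDiff_of_eqOn_zero hQ hT.isClosed hTQ (hf.congr hFf) hF0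
  have hFc : HasCompactSupport F := HasCompactSupport.intro hT hF0
  have hFt : tsupport F ⊆ J ×ˢ 𝒟 :=
    (closure_minimal (Function.support_subset_iff'.2 hF0) hT.isClosed).trans hTQ
  have h1 : ∫ q in J ×ˢ 𝒟, u.flowDeriv k q = ∫ q, u.flowDeriv k q :=
    setIntegral_eq_integral_of_forall_compl_eq_zero fun q hq => by
      rw [flowDeriv, IsTest.fderiv_eq_zero fun h => hq (hk.subset h)]; rfl
  have h2 : ∫ q in J ×ˢ 𝒟, fderiv ℝ F q (1, 0) = ∫ q, fderiv ℝ F q (1, 0) :=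
    setIntegral_eq_integral_of_forall_compl_eq_zero fun q hq => by
      rw [IsTest.fderiv_eq_zero fun h => hq (hFt h)]; rfl
  have h3 := integral_image_eq_integral_abs_det_fderiv_smul volume hQ.measurableSet
    (fun q hq => (hu.hasFDerivAt_toPos hJ h𝒟 hq).hasFDerivWithinAt) hu.injOn_toPos
    (u.flowDeriv k)
  rw [hu.image_toPos] at h3
  have := integral_fderiv_apply_eq_zero (μ := (volume : Measure (ℝ × Plane)))
    (hFs.of_le (by simp)) hFc (1, 0)
  rw [← h1, h3, ← this, ← h2]
  refine setIntegral_congr_fun hQ.measurableSet fun q hq => ?_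
  have h4 : HasDerivAt (fun s => |D₀ q.2| * k (s, u.φ s q.2))
      (|D₀ q.2| * u.flowDeriv k (u.toPos q)) q.1 :=
    (hu.hasDerivAt_along_flow hJ h𝒟 hq (hk.differentiable _)).const_mul _
  have h5 := hasDerivAt_slice_time (t := q.1) (x := q.2) (hFs.differentiable (by simp) q)
  have h6 : (fun s => F (s, q.2)) =ᶠ[𝓝 q.1] fun s => |D₀ q.2| * k (s, u.φ s q.2) := by
    filter_upwards [hJ.mem_nhds hq.1] with s hs using hFf (show (s, q.2) ∈ J ×ˢ 𝒟 from ⟨hs, hq.2⟩)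
  simp only [smul_eq_mul, hu.det_fderiv_toPos hJ h𝒟 hD hq]
  exact (h4.congr_of_eventuallyEq h6).unique h5

theorem integral_mul_flowDeriv (hD₀ : ContDiffOn ℝ ∞ D₀ 𝒟) {f χ : ℝ × Plane → ℝ}
    (hf : ContDiffOn ℝ ∞ f (J ×ˢ 𝒟)) (hχ : IsTest χ (J ×ˢ 𝒟)) :
    ∫ q, f q * u.flowDeriv χ q = - ∫ q, u.flowDeriv f q * χ q :=
  hχ.integral_mul_fderiv_apply (hJ.prod h𝒟)
    (contDiffOn_const.prodMk (hu.contDiffOn_velocity hJ h𝒟))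
    (fun _ hk => hu.integral_flowDeriv_eq_zero hJ h𝒟 hD hD₀ hk) hf

end State.IsSmoothOn

/-! ### Variations of the elevation and the pressure -/

theorem eq_zero_of_hasDerivAt_quadratic {f : ℝ → ℝ} {α β : ℝ} (hf : HasDerivAt f 0 0)
    (h : ∀ᶠ ε in 𝓝 (0 : ℝ), f ε = ε * α + ε ^ 2 * β) : α = 0 := by
  have h1 : HasDerivAt (fun ε : ℝ => ε * α + ε ^ 2 * β) (1 * α + (2 * 0) * β) 0 := by
    have h2 : HasDerivAt (fun ε : ℝ => ε ^ 2) (2 * 0) 0 := by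
      simpa using hasDerivAt_pow 2 (0 : ℝ)
    exact ((hasDerivAt_id (0 : ℝ)).mul_const α).add (h2.mul_const β)
  have := (h1.congr_of_eventuallyEq h).unique hf
  simpa using this

theorem integrableOn_of_eq_zero {E : Type*} [NormedAddCommGroup E] [MeasurableSpace E]
    [BorelSpace E] {μ : Measure E} [IsFiniteMeasureOnCompacts μ] {f : E → ℝ} {Q T : Set E}
    (hQ : MeasurableSet Q) (hT : IsCompact T) (hTQ : T ⊆ Q) (hf : ContinuousOn f Q)
    (h0 : ∀ q ∉ T, f q = 0) : IntegrableOn f Q μ :=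
  ((hf.mono hTQ).integrableOn_compact hT).of_forall_sdiff_eq_zero hQ fun q hq => h0 q hq.2

namespace State

variable {u : State} {J : Set ℝ} {𝒟 : Set Plane} {σ Fr ρref : ℝ} {D₀ ρ₀ : Plane → ℝ}

theorem IsSmoothOn.lagrangianDensity_eq (hu : u.IsSmoothOn J 𝒟) (hJ : IsOpen J)
    (h𝒟 : IsOpen 𝒟) {q : ℝ × Plane} (hq : q ∈ J ×ˢ 𝒟) :
    u.lagrangianDensity σ Fr ρref D₀ ρ₀ q.1 q.2 =
      (1 / 2 * (‖u.velocity q.1 q.2‖ ^ 2 + σ ^ 2 * u.verticalVelocity q.1 q.2 ^ 2)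
        - ρref / u.density ρ₀ q.1 q.2 * (u.ζ q.1 q.2 ^ 2 / (2 * Fr ^ 2)))
      * (u.areaDensity D₀ q.1 q.2 * u.density ρ₀ q.1 q.2)
      - u.p q.1 q.2 * (u.areaDensity D₀ q.1 q.2 - 1) := by
  rw [← hu.materialDeriv_ζ hJ h𝒟 hq]
  rfl

theorem IsSmoothOn.isTest_flowDeriv (hu : u.IsSmoothOn J 𝒟) (hJ : IsOpen J) (h𝒟 : IsOpen 𝒟)
    {χ : ℝ × Plane → ℝ} (hχ : IsTest χ (J ×ˢ 𝒟)) : IsTest (u.flowDeriv χ) (J ×ˢ 𝒟) :=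
  hχ.fderiv_apply (hJ.prod h𝒟) (contDiffOn_const.prodMk (hu.contDiffOn_velocity hJ h𝒟))

/-- The state `u` with elevation `ζ + ε α χ` and pressure `p + ε β χ`. -/
def perturb (u : State) (α β : ℝ) (χ : ℝ × Plane → ℝ) (ε : ℝ) : State where
  φ := u.φ
  ψ := u.ψ
  ζ := fun t x => u.ζ t x + ε * (α * χ (t, x))
  p := fun t x => u.p t x + ε * (β * χ (t, x))

variable {χ : ℝ × Plane → ℝ} (α β : ℝ)

theorem IsSmoothOn.perturb (hu : u.IsSmoothOn J 𝒟) (hχ : IsTest χ (J ×ˢ 𝒟)) (ε : ℝ) :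
    (u.perturb α β χ ε).IsSmoothOn J 𝒟 :=
  ⟨hu.mapsTo_φ, hu.mapsTo_ψ, hu.leftInv, hu.rightInv, hu.smooth_φ, hu.smooth_ψ,
    hu.smooth_ζ.add (contDiffOn_const.mul (contDiffOn_const.mul hχ.smooth.contDiffOn)),
    hu.smooth_p.add (contDiffOn_const.mul (contDiffOn_const.mul hχ.smooth.contDiffOn))⟩

theorem IsSmoothOn.isVariation_perturb (hu : u.IsSmoothOn J 𝒟) (hχ : IsTest χ (J ×ˢ 𝒟)) :
    u.IsVariation J 𝒟 (u.perturb α β χ) := by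
  have hs : MapsTo (Prod.snd : ℝ × ℝ × Plane → ℝ × Plane) (Ioo (-1) 1 ×ˢ J ×ˢ 𝒟) (J ×ˢ 𝒟) :=
    fun _ hz => hz.2
  have hadd : ∀ (g : ℝ × Plane → ℝ) (c : ℝ), ContDiffOn ℝ ∞ g (J ×ˢ 𝒟) →
      ContDiffOn ℝ ∞ (fun z : ℝ × ℝ × Plane => g z.2 + z.1 * (c * χ z.2))
        (Ioo (-1) 1 ×ˢ J ×ˢ 𝒟) := fun g c hg =>
    (hg.comp contDiffOn_snd hs).add (contDiffOn_fst.mul (contDiffOn_const.mul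
      (hχ.smooth.comp_contDiffOn contDiffOn_snd)))
  refine ⟨?_, 1, one_pos, fun ε _ => hu.perturb α β hχ ε, hu.smooth_φ.comp contDiffOn_snd hs,
    hu.smooth_ψ.comp contDiffOn_snd hs, hadd _ α hu.smooth_ζ, hadd _ β hu.smooth_p,
    tsupport χ, hχ.compact, hχ.subset, fun ε _ t _ x _ hx => ?_⟩
  · simp [State.perturb]
  · simp [State.perturb, image_eq_zero_of_notMem_tsupport hx]

theorem IsSmoothOn.verticalVelocity_perturb (hu : u.IsSmoothOn J 𝒟) (hJ : IsOpen J)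
    (h𝒟 : IsOpen 𝒟) (hχ : IsTest χ (J ×ˢ 𝒟)) (ε : ℝ) {q : ℝ × Plane} (hq : q ∈ J ×ˢ 𝒟) :
    (u.perturb α β χ ε).verticalVelocity q.1 q.2
      = u.verticalVelocity q.1 q.2 + ε * (α * u.flowDeriv χ q) := by
  rw [(hu.perturb α β hχ ε).verticalVelocity_eq hJ h𝒟 hq, hu.verticalVelocity_eq hJ h𝒟 hq]
  have h1 := (differentiableAt_of_contDiffOn (hJ.prod h𝒟) hu.smooth_ζ hq).hasFDerivAt
  have h2 := ((hχ.differentiable q).hasFDerivAt.const_mul α).const_mul ε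
  have h3 : HasFDerivAt (fun q : ℝ × Plane => (u.perturb α β χ ε).ζ q.1 q.2) _ q := h1.add h2
  rw [flowDeriv, h3.fderiv]
  rfl

/-- The first variation of the action in the elevation and the pressure. -/
theorem HamiltonPrinciple.integral_perturb_eq_zero {a b : ℝ}
    (hS : u.HamiltonPrinciple σ Fr ρref a b 𝒟 D₀ ρ₀) (hu : u.IsSmoothOn (Ioo a b) 𝒟)
    (h𝒟 : IsOpen 𝒟) (hD₀ : ContDiffOn ℝ ∞ D₀ 𝒟) (hρ₀ : ContDiffOn ℝ ∞ ρ₀ 𝒟)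
    (hρ₀pos : ∀ y ∈ 𝒟, 0 < ρ₀ y) (hχ : IsTest χ (Ioo a b ×ˢ 𝒟)) :
    ∫ q : ℝ × Plane, (α * (σ ^ 2 * u.verticalVelocity q.1 q.2 * u.flowDeriv χ q
        - ρref / u.density ρ₀ q.1 q.2 * (u.ζ q.1 q.2 * χ q / Fr ^ 2))
          * (u.areaDensity D₀ q.1 q.2 * u.density ρ₀ q.1 q.2)
        - β * χ q * (u.areaDensity D₀ q.1 q.2 - 1)) = 0 := by
  have hJ : IsOpen (Ioo a b) := isOpen_Ioo
  have hQ := hJ.prod h𝒟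
  set A : ℝ × Plane → ℝ := fun q => α * (σ ^ 2 * u.verticalVelocity q.1 q.2 * u.flowDeriv χ q
        - ρref / u.density ρ₀ q.1 q.2 * (u.ζ q.1 q.2 * χ q / Fr ^ 2))
          * (u.areaDensity D₀ q.1 q.2 * u.density ρ₀ q.1 q.2)
        - β * χ q * (u.areaDensity D₀ q.1 q.2 - 1) with hA
  let B : ℝ × Plane → ℝ := fun q => α ^ 2 * (1 / 2 * σ ^ 2 * u.flowDeriv χ q ^ 2
        - ρref / u.density ρ₀ q.1 q.2 * (χ q ^ 2 / (2 * Fr ^ 2)))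
          * (u.areaDensity D₀ q.1 q.2 * u.density ρ₀ q.1 q.2)
  have h0 : ∀ q ∉ tsupport χ, χ q = 0 ∧ u.flowDeriv χ q = 0 := fun q hq =>
    ⟨image_eq_zero_of_notMem_tsupport hq, by rw [flowDeriv, IsTest.fderiv_eq_zero hq]; rfl⟩
  have hA0 : ∀ q ∉ tsupport χ, A q = 0 := fun q hq => by simp [hA, h0 q hq]
  have hB0 : ∀ q ∉ tsupport χ, B q = 0 := fun q hq => by simp [B, h0 q hq]
  have c1 := (hu.contDiffOn_verticalVelocity hJ h𝒟).continuousOn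
  have c2 := (hu.contDiffOn_flowDeriv hJ h𝒟 hχ.smooth.contDiffOn).continuousOn
  have c3 := (hu.contDiffOn_density hρ₀).continuousOn
  have c4 := hu.smooth_ζ.continuousOn
  have c5 := hu.continuousOn_areaDensity hJ h𝒟 hD₀
  have c6 : ContinuousOn χ (Ioo a b ×ˢ 𝒟) := hχ.smooth.continuous.continuousOn
  have c7 : ContinuousOn (fun q : ℝ × Plane => ρref / u.density ρ₀ q.1 q.2) (Ioo a b ×ˢ 𝒟) :=
    continuousOn_const.div c3 fun q hq => (hρ₀pos _ (hu.mapsTo_toLabel hq).2).ne'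
  have hAc : ContinuousOn A (Ioo a b ×ˢ 𝒟) := by fun_prop
  have hBc : ContinuousOn B (Ioo a b ×ˢ 𝒟) := by fun_prop
  have hAi : IntegrableOn A (Ioo a b ×ˢ 𝒟) volume :=
    integrableOn_of_eq_zero hQ.measurableSet hχ.compact hχ.subset hAc hA0
  have hBi : IntegrableOn B (Ioo a b ×ˢ 𝒟) volume :=
    integrableOn_of_eq_zero hQ.measurableSet hχ.compact hχ.subset hBc hB0
  -- With the current fixed, the density is quadratic in the elevation and its derivatives and
  -- affine in the pressure, so expanding in `ε` is exact.
  have key : ∀ ε, actionIncrement σ Fr ρref a b 𝒟 D₀ ρ₀ u (u.perturb α β χ ε)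
      = ε * (∫ q in Ioo a b ×ˢ 𝒟, A q) + ε ^ 2 * ∫ q in Ioo a b ×ˢ 𝒟, B q := by
    intro ε
    rw [← integral_const_mul, ← integral_const_mul,
      ← integral_add (hAi.const_mul ε) (hBi.const_mul (ε ^ 2))]
    refine setIntegral_congr_fun hQ.measurableSet fun q hq => ?_
    rw [(hu.perturb α β hχ ε).lagrangianDensity_eq hJ h𝒟 hq, hu.lagrangianDensity_eq hJ h𝒟 hq,
      hu.verticalVelocity_perturb α β hJ h𝒟 hχ ε hq]
    have e1 : (u.perturb α β χ ε).velocity q.1 q.2 = u.velocity q.1 q.2 := rfl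
    have e2 : (u.perturb α β χ ε).density ρ₀ q.1 q.2 = u.density ρ₀ q.1 q.2 := rfl
    have e3 : (u.perturb α β χ ε).areaDensity D₀ q.1 q.2 = u.areaDensity D₀ q.1 q.2 := rfl
    have e4 : (u.perturb α β χ ε).ζ q.1 q.2 = u.ζ q.1 q.2 + ε * (α * χ q) := rfl
    have e5 : (u.perturb α β χ ε).p q.1 q.2 = u.p q.1 q.2 + ε * (β * χ q) := rfl
    rw [e1, e2, e3, e4, e5]
    simp only [hA, B]
    ring
  rw [← setIntegral_eq_integral_of_forall_compl_eq_zero (s := Ioo a b ×ˢ 𝒟) (f := A)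
    fun q hq => hA0 q fun h => hq (hχ.subset h)]
  exact eq_zero_of_hasDerivAt_quadratic (hS _ (hu.isVariation_perturb α β hχ))
    (Eventually.of_forall key)

section EulerLagrange

variable {a b : ℝ} (hS : u.HamiltonPrinciple σ Fr ρref a b 𝒟 D₀ ρ₀)
  (hu : u.IsSmoothOn (Ioo a b) 𝒟) (h𝒟 : IsOpen 𝒟) (hD₀ : ContDiffOn ℝ ∞ D₀ 𝒟)
  (hρ₀ : ContDiffOn ℝ ∞ ρ₀ 𝒟) (hρ₀pos : ∀ y ∈ 𝒟, 0 < ρ₀ y)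
include hS hu h𝒟 hD₀ hρ₀ hρ₀pos

/-- The pressure equation: the areal density is constant. -/
theorem HamiltonPrinciple.areaDensity_eq_one :
    ∀ q ∈ Ioo a b ×ˢ 𝒟, u.areaDensity D₀ q.1 q.2 = 1 := by
  have hJ : IsOpen (Ioo a b) := isOpen_Ioo
  have h := eq_zero_of_forall_integral_eq_zero (μ := (volume : Measure (ℝ × Plane)))
    (hJ.prod h𝒟) ((hu.continuousOn_areaDensity hJ h𝒟 hD₀).sub (continuousOn_const (c := (1 : ℝ))))
    fun χ hχ => by
      -- Varying the pressure alone, with sign -1, leaves the integrand `χ (D - 1)`.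
      have h1 := hS.integral_perturb_eq_zero 0 (-1) hu h𝒟 hD₀ hρ₀ hρ₀pos hχ
      rw [← h1]
      refine integral_congr_ae (ae_of_all _ fun q => ?_)
      simp only [Pi.sub_apply]
      ring
  exact fun q hq => sub_eq_zero.1 (h q hq)

/-- The elevation equation. -/
theorem HamiltonPrinciple.elevation_equation :
    ∀ q ∈ Ioo a b ×ˢ 𝒟, σ ^ 2 * u.density ρ₀ q.1 q.2 *
      u.flowDeriv (fun q : ℝ × Plane => u.verticalVelocity q.1 q.2) q
        = -(ρref * u.ζ q.1 q.2 / Fr ^ 2) := by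
  have hJ : IsOpen (Ioo a b) := isOpen_Ioo
  have hQ := hJ.prod h𝒟
  have hD := hS.areaDensity_eq_one hu h𝒟 hD₀ hρ₀ hρ₀pos
  have hw := hu.contDiffOn_verticalVelocity hJ h𝒟
  have hρ := hu.contDiffOn_density hρ₀
  have hf : ContDiffOn ℝ ∞ (fun q : ℝ × Plane =>
      σ ^ 2 * (u.verticalVelocity q.1 q.2 * u.density ρ₀ q.1 q.2)) (Ioo a b ×ˢ 𝒟) :=
    contDiffOn_const.mul (hw.mul hρ)
  have hz : ContDiffOn ℝ ∞ (fun q : ℝ × Plane => ρref * u.ζ q.1 q.2 / Fr ^ 2) (Ioo a b ×ˢ 𝒟) :=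
    (contDiffOn_const.mul hu.smooth_ζ).div_const _
  have hfd := hu.contDiffOn_flowDeriv hJ h𝒟 hf
  have h := eq_zero_of_forall_integral_eq_zero (μ := (volume : Measure (ℝ × Plane)))
    hQ (hfd.add hz).continuousOn fun χ hχ => by
      have h1 := hS.integral_perturb_eq_zero 1 0 hu h𝒟 hD₀ hρ₀ hρ₀pos hχ
      have h2 := hu.integral_mul_flowDeriv hJ h𝒟 hD hD₀ hf hχ
      have i1 := (hχ.mul_left hQ hfd).integrable (volume : Measure (ℝ × Plane))
      have i2 := (hχ.mul_left hQ hz).integrable (volume : Measure (ℝ × Plane))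
      have i3 := ((hu.isTest_flowDeriv hJ h𝒟 hχ).mul_left hQ hf).integrable (volume : Measure (ℝ × Plane))
      simp only [add_mul]
      rw [integral_add i1 i2, ← neg_neg (∫ q, _ * χ q), ← h2, neg_add_eq_zero,
        ← sub_eq_zero, ← integral_sub i3 i2, ← h1]
      refine integral_congr_ae (ae_of_all _ fun q => ?_)
      by_cases hq : q ∈ tsupport χ
      · have hq' := hχ.subset hq
        have hρ' : u.density ρ₀ q.1 q.2 ≠ 0 := (hρ₀pos _ (hu.mapsTo_toLabel hq').2).ne'
        -- On the support `D = 1`, and the factor `ρ` cancels the denominator of the buoyancy term.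
        simp only [hD q hq', flowDeriv]
        field_simp
        ring
      · simp [flowDeriv, IsTest.fderiv_eq_zero hq, image_eq_zero_of_notMem_tsupport hq]
  intro q hq
  have h1 := h q hq
  have d1 := (differentiableAt_of_contDiffOn hQ hw hq).hasFDerivAt
  have d2 := (differentiableAt_of_contDiffOn hQ hρ hq).hasFDerivAt
  have d3 : HasFDerivAt (fun q : ℝ × Plane =>
      σ ^ 2 * (u.verticalVelocity q.1 q.2 * u.density ρ₀ q.1 q.2)) _ q :=
    (d1.mul d2).const_mul (σ ^ 2)
  -- Since `ρ` is materially constant, the product rule leaves only the derivative of `ŵ`.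
  have d4 := hu.flowDeriv_density hJ h𝒟 hρ₀ hq
  simp only [flowDeriv, d3.fderiv] at h1 d4 ⊢
  simp [d4] at h1
  linarith

end EulerLagrange

end State

/-! ### Transport of a state by a shear of the position space -/

section ShearPreserves

variable {E : Type*} [NormedAddCommGroup E] [NormedSpace ℝ E] {χ : E → ℝ} {v : E} {ε : ℝ}
  {Q : Set E}

theorem shearInv_shear (h : Function.Bijective (shear χ v ε)) (q : E) :
    shearInv χ v ε (shear χ v ε q) = q :=
  Function.leftInverse_invFun h.1 q

theorem shear_shearInv (h : Function.Bijective (shear χ v ε)) (q : E) :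
    shear χ v ε (shearInv χ v ε q) = q :=
  Function.rightInverse_invFun h.2 q

/-- A point outside `Q` is fixed by the shear. If the image of `q` lay outside, it would be fixed
too, and injectivity would identify it with `q`. -/
theorem mapsTo_shear (h : Function.Bijective (shear χ v ε)) (hQ : ∀ q ∉ Q, χ q = 0) :
    MapsTo (shear χ v ε) Q Q := fun q hq => by
  by_contra h'
  have h1 : shear χ v ε q = q := h.1 (shear_of_eq_zero (hQ _ h'))
  exact h' (h1.symm ▸ hq)

theorem mapsTo_shearInv (h : Function.Bijective (shear χ v ε)) (hQ : ∀ q ∉ Q, χ q = 0) :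
    MapsTo (shearInv χ v ε) Q Q := fun q hq => by
  by_contra h'
  have h1 : shearInv χ v ε q = q := (shear_of_eq_zero (hQ _ h')).symm.trans (shear_shearInv h q)
  exact h' (h1.symm ▸ hq)

theorem image_shear (h : Function.Bijective (shear χ v ε)) (hQ : ∀ q ∉ Q, χ q = 0) :
    shear χ v ε '' Q = Q :=
  Subset.antisymm (mapsTo_shear h hQ).image_subset
    fun q hq => ⟨_, mapsTo_shearInv h hQ hq, shear_shearInv h q⟩

theorem shearInv_of_eq_zero (h : Function.Bijective (shear χ v ε)) {q : E} (hq : χ q = 0) :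
    shearInv χ v ε q = q := by
  conv_lhs => rw [← shear_of_eq_zero (v := v) (ε := ε) hq]
  exact shearInv_shear h q

end ShearPreserves

section SpaceTimeShear

variable {χ : ℝ × Plane → ℝ} {e : Plane} {ε : ℝ}

theorem shear_fst (q : ℝ × Plane) : (shear χ (0, e) ε q).1 = q.1 := by simp [shear]

theorem shear_snd (q : ℝ × Plane) : (shear χ (0, e) ε q).2 = q.2 + (ε * χ q) • e := by
  simp [shear]

theorem shearInv_fst (h : Function.Bijective (shear χ (0, e) ε)) (q : ℝ × Plane) :
    (shearInv χ (0, e) ε q).1 = q.1 := by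
  conv_rhs => rw [← shear_shearInv h q, shear_fst]

theorem mk_shear_snd (q : ℝ × Plane) :
    (q.1, (shear χ (0, e) ε q).2) = shear χ (0, e) ε q := Prod.ext (shear_fst q).symm rfl

theorem mk_shearInv_snd (h : Function.Bijective (shear χ (0, e) ε)) (q : ℝ × Plane) :
    (q.1, (shearInv χ (0, e) ε q).2) = shearInv χ (0, e) ε q :=
  Prod.ext (shearInv_fst h q).symm rfl

end SpaceTimeShear

namespace State

/-- The state that is transported by the shear of the position space: the current map is composed
with the shear, and the elevation and the pressure are advected by it. -/
noncomputable def push (u : State) (e : Plane) (χ : ℝ × Plane → ℝ) (ε : ℝ) : State where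
  φ := fun t y => (shear χ (0, e) ε (t, u.φ t y)).2
  ψ := fun t x => u.ψ t (shearInv χ (0, e) ε (t, x)).2
  ζ := fun t x => u.ζ t (shearInv χ (0, e) ε (t, x)).2
  p := fun t x => u.p t (shearInv χ (0, e) ε (t, x)).2

variable {u : State} {J : Set ℝ} {𝒟 : Set Plane} {σ Fr ρref : ℝ} {D₀ ρ₀ : Plane → ℝ}
  {χ : ℝ × Plane → ℝ} {e : Plane} {δ : ℝ}

theorem push_zero (u : State) (e : Plane) (χ : ℝ × Plane → ℝ) : u.push e χ 0 = u := by
  simp [push, shear_zero, shearInv_zero]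

theorem toPos_push (ε : ℝ) (q : ℝ × Plane) :
    (u.push e χ ε).toPos q = shear χ (0, e) ε (u.toPos q) :=
  mk_shear_snd (u.toPos q)

theorem ψ_push {ε : ℝ} (hb : Function.Bijective (shear χ (0, e) ε)) (q : ℝ × Plane) :
    (u.push e χ ε).ψ q.1 (shear χ (0, e) ε q).2 = u.ψ q.1 q.2 := by
  simp only [push, mk_shear_snd, shearInv_shear hb]

/-- The elevation is advected by the shear, so every parcel has the same height at every time as
before. -/
theorem verticalVelocity_push {ε : ℝ} (hb : Function.Bijective (shear χ (0, e) ε))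
    (q : ℝ × Plane) :
    (u.push e χ ε).verticalVelocity q.1 (shear χ (0, e) ε q).2 = u.verticalVelocity q.1 q.2 := by
  have h : ∀ s y, (u.push e χ ε).ζ s ((u.push e χ ε).φ s y) = u.ζ s (u.φ s y) := fun s y => by
    have h1 := mk_shear_snd (χ := χ) (e := e) (ε := ε) (s, u.φ s y)
    simp only [push]
    rw [h1, shearInv_shear hb]
  simp only [verticalVelocity, h, ψ_push hb]

section Variation

variable (hu : u.IsSmoothOn J 𝒟) (hχ : IsTest χ (J ×ˢ 𝒟))
  (hδ : ∀ ε ∈ Ioo (-δ) δ, Function.Bijective (shear χ (0, e) ε) ∧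
    ∀ q, 0 < 1 + ε * fderiv ℝ χ q (0, e))
include hu hχ

theorem contDiffOn_push_φ :
    ContDiffOn ℝ ∞ (fun z : ℝ × ℝ × Plane => (u.push e χ z.1).φ z.2.1 z.2.2)
      (Ioo (-δ) δ ×ˢ J ×ˢ 𝒟) :=
  contDiff_snd.comp_contDiffOn ((contDiff_shear hχ.smooth (0, e)).comp_contDiffOn
    (contDiffOn_fst.prodMk (hu.contDiffOn_toPos.comp contDiffOn_snd fun _ hz => hz.2)))

include hδ

omit hu in
theorem contDiffOn_comp_shearInv {F : Type*} [NormedAddCommGroup F] [NormedSpace ℝ F]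
    {f : ℝ → Plane → F} (hf : ContDiffOn ℝ ∞ (fun q : ℝ × Plane => f q.1 q.2) (J ×ˢ 𝒟)) :
    ContDiffOn ℝ ∞ (fun z : ℝ × ℝ × Plane =>
      f z.2.1 (shearInv χ (0, e) z.1 (z.2.1, z.2.2)).2) (Ioo (-δ) δ ×ˢ J ×ˢ 𝒟) := by
  have h0 : ∀ q ∉ J ×ˢ 𝒟, χ q = 0 := fun q hq =>
    image_eq_zero_of_notMem_tsupport fun h => hq (hχ.subset h)
  have h1 : ContDiffOn ℝ ∞ (fun z : ℝ × ℝ × Plane => shearInv χ (0, e) z.1 z.2)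
      (Ioo (-δ) δ ×ˢ J ×ˢ 𝒟) :=
    (contDiffOn_shearInv hχ.smooth hδ).mono (prod_mono_right (subset_univ _))
  refine (hf.comp h1 fun z hz => mapsTo_shearInv (hδ z.1 hz.1).1 h0 hz.2).congr fun z hz => ?_
  simp only [Function.comp_apply, shearInv_fst (hδ z.1 hz.1).1]

theorem IsSmoothOn.push {ε : ℝ} (hε : ε ∈ Ioo (-δ) δ) : (u.push e χ ε).IsSmoothOn J 𝒟 := by
  have h0 : ∀ q ∉ J ×ˢ 𝒟, χ q = 0 := fun q hq =>
    image_eq_zero_of_notMem_tsupport fun h => hq (hχ.subset h)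
  have hb := (hδ ε hε).1
  have hslice : ContDiffOn ℝ ∞ (fun q : ℝ × Plane => (ε, q)) (J ×ˢ 𝒟) :=
    contDiffOn_const.prodMk contDiffOn_id
  have hm : MapsTo (fun q : ℝ × Plane => (ε, q)) (J ×ˢ 𝒟) (Ioo (-δ) δ ×ˢ J ×ˢ 𝒟) :=
    fun q hq => ⟨hε, hq⟩
  have hR : ∀ t ∈ J, ∀ x ∈ 𝒟, (shearInv χ (0, e) ε (t, x)).2 ∈ 𝒟 := fun t ht x hx =>
    (mapsTo_shearInv hb h0 (show (t, x) ∈ J ×ˢ 𝒟 from ⟨ht, hx⟩)).2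
  refine ⟨fun t ht y hy => ?_, fun t ht x hx => ?_, fun t ht y hy => ?_, fun t ht x hx => ?_,
    (contDiffOn_push_φ hu hχ).comp hslice hm,
    (contDiffOn_comp_shearInv hχ hδ hu.smooth_ψ).comp hslice hm,
    (contDiffOn_comp_shearInv hχ hδ hu.smooth_ζ).comp hslice hm,
    (contDiffOn_comp_shearInv hχ hδ hu.smooth_p).comp hslice hm⟩
  · exact (mapsTo_shear hb h0 (show (t, u.φ t y) ∈ J ×ˢ 𝒟 from ⟨ht, hu.mapsTo_φ t ht hy⟩)).2
  · exact hu.mapsTo_ψ t ht (hR t ht x hx)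
  · have h1 := mk_shear_snd (χ := χ) (e := e) (ε := ε) (t, u.φ t y)
    simp only [State.push]
    rw [h1, shearInv_shear hb]
    exact hu.leftInv t ht hy
  · have h1 : u.φ t (u.ψ t (shearInv χ (0, e) ε (t, x)).2) = (shearInv χ (0, e) ε (t, x)).2 :=
      hu.rightInv t ht (hR t ht x hx)
    have h2 := mk_shearInv_snd hb (t, x)
    simp only [State.push]
    rw [h1, h2, shear_shearInv hb]

/-- The compact set has two pieces: `ζ` and `p` change at positions in the support of `χ`, whereas
`φ` changes at the labels that the current carries into that support. -/
theorem isVariation_push (hpos : 0 < δ) : u.IsVariation J 𝒟 (u.push e χ) := by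
  refine ⟨push_zero u e χ, δ, hpos, fun ε hε => hu.push hχ hδ hε, contDiffOn_push_φ hu hχ,
    contDiffOn_comp_shearInv hχ hδ hu.smooth_ψ, contDiffOn_comp_shearInv hχ hδ hu.smooth_ζ,
    contDiffOn_comp_shearInv hχ hδ hu.smooth_p, tsupport χ ∪ u.toLabel '' tsupport χ,
    hχ.compact.isCompact.union (hχ.compact.isCompact.image_of_continuousOn
      (hu.contDiffOn_toLabel.continuousOn.mono hχ.subset)),
    union_subset hχ.subset (hu.mapsTo_toLabel.mono_left hχ.subset).image_subset,
    fun ε hε t ht x hx hK => ?_⟩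
  rw [mem_union, not_or] at hK
  have hb := (hδ ε hε).1
  have hq : (t, x) ∈ J ×ˢ 𝒟 := ⟨ht, hx⟩
  have h1 : χ (t, x) = 0 := image_eq_zero_of_notMem_tsupport hK.1
  have h2 : χ (t, u.φ t x) = 0 := image_eq_zero_of_notMem_tsupport
    fun h => hK.2 ⟨_, h, hu.toLabel_toPos hq⟩
  simp [push, shear_of_eq_zero h2, shearInv_of_eq_zero hb h1]

variable (hJ : IsOpen J) (h𝒟 : IsOpen 𝒟) {ε : ℝ} (hε : ε ∈ Ioo (-δ) δ) {q : ℝ × Plane}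
  (hq : q ∈ J ×ˢ 𝒟)
include hJ h𝒟 hε hq

/-- The new trajectory of a parcel is the old one plus `ε χ e` evaluated along the old one, and `χ`
changes along it at the rate `flowDeriv χ`. -/
theorem velocity_push :
    (u.push e χ ε).velocity q.1 (shear χ (0, e) ε q).2
      = u.velocity q.1 q.2 + (ε * u.flowDeriv χ q) • e := by
  have hv := hu.push hχ hδ hε
  have hy := hu.mapsTo_toLabel hq
  have hqy := hu.toPos_toLabel hq
  have h1 := hv.velocity_toPos hJ h𝒟 hy
  have h2 := (hu.hasDerivAt_along_flow hJ h𝒟 hy (hχ.differentiable _)).const_mul ε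
  have h3 := (hu.hasDerivAt_φ hJ h𝒟 hy).add (h2.smul_const e)
  rw [← hu.velocity_eq hJ h𝒟 hq, hqy] at h3
  have h4 := hv.hasDerivAt_φ hJ h𝒟 hy
  have h5 : (fun s => (u.push e χ ε).φ s (u.toLabel q).2)
      = (fun s => u.φ s (u.toLabel q).2) + fun s => (ε * χ (s, u.φ s (u.toLabel q).2)) • e := by
    funext s
    simp only [push, Pi.add_apply, shear_snd]
  rw [h5] at h4
  rw [← h3.unique h4] at h1
  have h6 := toPos_push (u := u) (e := e) (χ := χ) ε (u.toLabel q)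
  rw [hqy] at h6
  have h7 : (u.push e χ ε).φ q.1 (u.toLabel q).2 = (shear χ (0, e) ε q).2 :=
    (congrArg Prod.snd h6 :)
  rw [← h7]
  exact h1

/-- Both states transport the same `D₀`, and the shear multiplies the determinant of the current map
by its own Jacobian, so the areal density is divided by that Jacobian. -/
theorem areaDensity_push :
    (u.push e χ ε).areaDensity D₀ q.1 (shear χ (0, e) ε q).2
        * (1 + ε * fderiv ℝ χ q (0, e)) = u.areaDensity D₀ q.1 q.2 := by
  have hv := hu.push hχ hδ hε
  have hy := hu.mapsTo_toLabel hq
  have hqy := hu.toPos_toLabel hq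
  have hqy' : u.φ q.1 (u.toLabel q).2 = q.2 := congrArg Prod.snd hqy
  have h1 := hu.det_fderiv_φ_mul_det_fderiv_ψ hJ h𝒟 hy
  have h2 := hv.det_fderiv_φ_mul_det_fderiv_ψ hJ h𝒟 hy
  have h3 : (u.push e χ ε).φ q.1 (u.toLabel q).2 = (shear χ (0, e) ε q).2 := by
    have := congrArg Prod.snd (toPos_push (u := u) (e := e) (χ := χ) ε (u.toLabel q))
    rwa [hqy] at this
  have hS : HasFDerivAt (fun x : Plane => x + (ε * χ (q.1, x)) • e)
      (ContinuousLinearMap.id ℝ Plane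
        + (ε • (fderiv ℝ χ q).comp (.inr ℝ ℝ Plane)).smulRight e) q.2 :=
    (hasFDerivAt_id _).add (((hasFDerivAt_slice_space (t := q.1) (x := q.2)
      (hχ.differentiable q)).const_mul ε).smul_const e)
  have hφ := (hu.hasFDerivAt_φ hJ h𝒟 hy).differentiableAt.hasFDerivAt
  rw [← hqy'] at hS
  have hc := hS.comp (u.toLabel q).2 hφ
  have hc' : (fun x : Plane => x + (ε * χ (q.1, x)) • e) ∘ u.φ q.1 = (u.push e χ ε).φ q.1 := by
    funext y
    simp only [push, Function.comp_apply, shear_snd]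
  have hc1 : HasFDerivAt ((u.push e χ ε).φ q.1) _ (u.toLabel q).2 := hc' ▸ hc
  have h4 : (fderiv ℝ ((u.push e χ ε).φ q.1) (u.toLabel q).2).det
      = (1 + ε * fderiv ℝ χ q (0, e)) * (fderiv ℝ (u.φ q.1) (u.toLabel q).2).det := by
    rw [hc1.fderiv]
    have h5 := det_id_add_smulRight (ε • (fderiv ℝ χ q).comp (.inr ℝ ℝ Plane)) e
    rw [ContinuousLinearMap.det] at h5 ⊢
    rw [ContinuousLinearMap.toLinearMap_comp, LinearMap.det_comp, h5]
    simp [ContinuousLinearMap.det, toLabel]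
  have e1 : (u.toLabel q).1 = q.1 := rfl
  rw [e1, hqy'] at h1
  rw [e1, h3, h4] at h2
  have h6 : (fderiv ℝ (u.φ q.1) (u.toLabel q).2).det ≠ 0 := right_ne_zero_of_mul_eq_one h1
  simp only [areaDensity, ψ_push (hδ ε hε).1]
  rw [mul_assoc]
  congr 1
  apply mul_right_cancel₀ h6
  rw [h1, mul_assoc, h2]

/-- The space-time density of the transported state, pulled back by the shear, when the areal
density of `u` is constant. -/
theorem lagrangianDensity_push (hD : u.areaDensity D₀ q.1 q.2 = 1)
    (hρ : u.density ρ₀ q.1 q.2 ≠ 0) :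
    (1 + ε * fderiv ℝ χ q (0, e)) * (u.push e χ ε).lagrangianDensity σ Fr ρref D₀ ρ₀
        q.1 (shear χ (0, e) ε q).2
      = u.lagrangianDensity σ Fr ρref D₀ ρ₀ q.1 q.2
        + ε * (u.density ρ₀ q.1 q.2 * inner ℝ (u.velocity q.1 q.2) e * u.flowDeriv χ q
          + u.p q.1 q.2 * fderiv ℝ χ q (0, e))
        + ε ^ 2 * (1 / 2 * u.density ρ₀ q.1 q.2 * ‖e‖ ^ 2 * u.flowDeriv χ q ^ 2) := by
  have hv := hu.push hχ hδ hε
  have hb := (hδ ε hε).1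
  have hq' : shear χ (0, e) ε q ∈ J ×ˢ 𝒟 := mapsTo_shear hb (fun q hq =>
    image_eq_zero_of_notMem_tsupport fun h => hq (hχ.subset h)) hq
  have hJpos := (hδ ε hε).2 q
  have h1 := areaDensity_push hu hχ hδ hJ h𝒟 hε hq (D₀ := D₀)
  rw [hD] at h1
  have h2 := hv.lagrangianDensity_eq hJ h𝒟 hq' (σ := σ) (Fr := Fr) (ρref := ρref) (D₀ := D₀)
    (ρ₀ := ρ₀)
  rw [shear_fst] at h2
  rw [h2, hu.lagrangianDensity_eq hJ h𝒟 hq, hD,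
    velocity_push hu hχ hδ hJ h𝒟 hε hq, verticalVelocity_push hb]
  have e2 : (u.push e χ ε).density ρ₀ q.1 (shear χ (0, e) ε q).2
      = u.density ρ₀ q.1 q.2 := by simp only [density, ψ_push (hδ ε hε).1]
  have e3 : (u.push e χ ε).ζ q.1 (shear χ (0, e) ε q).2 = u.ζ q.1 q.2 := by
    simp only [push, mk_shear_snd, shearInv_shear hb]
  have e4 : (u.push e χ ε).p q.1 (shear χ (0, e) ε q).2 = u.p q.1 q.2 := by
    simp only [push, mk_shear_snd, shearInv_shear hb]
  rw [e2, e3, e4, norm_add_sq_real, inner_smul_right, norm_smul, mul_pow, Real.norm_eq_abs, sq_abs]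
  set Δ := (u.push e χ ε).areaDensity D₀ q.1 (shear χ (0, e) ε q).2
  set j := fderiv ℝ χ q (0, e)
  -- As `D = 1`, the new areal density cancels the Jacobian in the kinetic and potential terms. The
  -- constraint term contributes `p ((1 + ε j) - 1) = ε p j`.
  have hΔ : Δ = 1 / (1 + ε * j) := by
    rw [eq_div_iff hJpos.ne']; exact h1
  have hj : 1 + ε * j ≠ 0 := hJpos.ne'
  rw [hΔ]
  field_simp
  ring

end Variation

end State

/-! ### Variation of the current map and the horizontal momentum equation -/

namespace State

variable {u : State} {𝒟 : Set Plane} {σ Fr ρref a b : ℝ} {D₀ ρ₀ : Plane → ℝ}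
  (hS : u.HamiltonPrinciple σ Fr ρref a b 𝒟 D₀ ρ₀)
  (hu : u.IsSmoothOn (Ioo a b) 𝒟) (h𝒟 : IsOpen 𝒟) (hD₀ : ContDiffOn ℝ ∞ D₀ 𝒟)
  (hρ₀ : ContDiffOn ℝ ∞ ρ₀ 𝒟) (hρ₀pos : ∀ y ∈ 𝒟, 0 < ρ₀ y)
include hS hu h𝒟 hD₀ hρ₀ hρ₀pos

/-- The first variation of the action in the current map, with the elevation and the pressure
carried along. -/
theorem HamiltonPrinciple.integral_push_eq_zero (e : Plane) {χ : ℝ × Plane → ℝ}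
    (hχ : IsTest χ (Ioo a b ×ˢ 𝒟)) :
    ∫ q : ℝ × Plane, (u.density ρ₀ q.1 q.2 * inner ℝ (u.velocity q.1 q.2) e * u.flowDeriv χ q
      + u.p q.1 q.2 * fderiv ℝ χ q (0, e)) = 0 := by
  have hJ : IsOpen (Ioo a b) := isOpen_Ioo
  have hQ := hJ.prod h𝒟
  have hD := hS.areaDensity_eq_one hu h𝒟 hD₀ hρ₀ hρ₀pos
  have hρne : ∀ q ∈ Ioo a b ×ˢ 𝒟, u.density ρ₀ q.1 q.2 ≠ 0 := fun q hq =>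
    (hρ₀pos _ (hu.mapsTo_toLabel hq).2).ne'
  obtain ⟨δ, hδpos, hδ⟩ := exists_bijective_shear hχ.smooth hχ.compact ((0 : ℝ), e)
  set A : ℝ × Plane → ℝ := fun q =>
    u.density ρ₀ q.1 q.2 * inner ℝ (u.velocity q.1 q.2) e * u.flowDeriv χ q
      + u.p q.1 q.2 * fderiv ℝ χ q (0, e) with hA
  let B : ℝ × Plane → ℝ := fun q =>
    1 / 2 * u.density ρ₀ q.1 q.2 * ‖e‖ ^ 2 * u.flowDeriv χ q ^ 2
  let L : ℝ × Plane → ℝ := fun q => u.lagrangianDensity σ Fr ρref D₀ ρ₀ q.1 q.2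
  let T : Set (ℝ × Plane) := tsupport χ
  have hTc : IsCompact T := hχ.compact
  have hTm : MeasurableSet T := (isClosed_tsupport χ).measurableSet
  have hTQ : T ⊆ Ioo a b ×ˢ 𝒟 := hχ.subset
  have h0 : ∀ q ∉ T, u.flowDeriv χ q = 0 ∧ fderiv ℝ χ q (0, e) = 0 := fun q hq => by
    constructor
    · rw [flowDeriv, IsTest.fderiv_eq_zero hq]; rfl
    · rw [IsTest.fderiv_eq_zero hq]; rfl
  have c0 := (hu.contDiffOn_velocity hJ h𝒟).continuousOn
  have c1 := (hu.contDiffOn_verticalVelocity hJ h𝒟).continuousOn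
  have c2 := (hu.contDiffOn_flowDeriv hJ h𝒟 hχ.smooth.contDiffOn).continuousOn
  have c3 := (hu.contDiffOn_density hρ₀).continuousOn
  have c4 := hu.smooth_ζ.continuousOn
  have c5 := hu.smooth_p.continuousOn
  have c6 : ContinuousOn (fun q => fderiv ℝ χ q (0, e)) (Ioo a b ×ˢ 𝒟) :=
    (contDiffOn_fderiv_apply hQ hχ.smooth.contDiffOn contDiffOn_const).continuousOn
  have c7 : ContinuousOn (fun q : ℝ × Plane => ρref / u.density ρ₀ q.1 q.2) (Ioo a b ×ˢ 𝒟) :=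
    continuousOn_const.div c3 hρne
  have c8 := hu.continuousOn_areaDensity hJ h𝒟 hD₀
  have hAc : ContinuousOn A (Ioo a b ×ˢ 𝒟) := by fun_prop
  have hBc : ContinuousOn B (Ioo a b ×ˢ 𝒟) := by fun_prop
  have hLc : ContinuousOn L (Ioo a b ×ˢ 𝒟) := by
    refine ContinuousOn.congr ?_ fun q hq => hu.lagrangianDensity_eq hJ h𝒟 hq
    fun_prop
  have hAi : IntegrableOn A T volume := (hAc.mono hTQ).integrableOn_compact hTc
  have hBi : IntegrableOn B T volume := (hBc.mono hTQ).integrableOn_compact hTc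
  have hLi : IntegrableOn L T volume := (hLc.mono hTQ).integrableOn_compact hTc
  have key : ∀ ε ∈ Ioo (-δ) δ, actionIncrement σ Fr ρref a b 𝒟 D₀ ρ₀ u (u.push e χ ε)
      = ε * (∫ q in T, A q) + ε ^ 2 * ∫ q in T, B q := by
    intro ε hε
    have hb := (hδ ε hε).1
    let L' : ℝ × Plane → ℝ := fun q => (u.push e χ ε).lagrangianDensity σ Fr ρref D₀ ρ₀ q.1 q.2
    have hpull : ∀ q ∈ Ioo a b ×ˢ 𝒟,
        (1 + ε * fderiv ℝ χ q (0, e)) * L' (shear χ (0, e) ε q)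
          = L q + ε * A q + ε ^ 2 * B q := fun q hq => by
      simp only [L', shear_fst]
      exact lagrangianDensity_push hu hχ hδ hJ h𝒟 hε hq (hD q hq) (hρne q hq)
    -- The support of `χ` is invariant under the shear, so the change of variables takes place on
    -- one fixed compact set.
    have hTimg : shear χ (0, e) ε '' T = T :=
      image_shear hb fun q hq => image_eq_zero_of_notMem_tsupport hq
    have hder : ∀ q ∈ T, HasFDerivWithinAt (shear χ (0, e) ε)
        (ContinuousLinearMap.id ℝ (ℝ × Plane) + (ε • fderiv ℝ χ q).smulRight (0, e)) T q :=
      fun q _ => (hasFDerivAt_shear hχ.smooth (0, e) ε q).hasFDerivWithinAt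
    have hjac : ∀ q ∈ T, |(ContinuousLinearMap.id ℝ (ℝ × Plane)
        + (ε • fderiv ℝ χ q).smulRight (0, e)).det| • L' (shear χ (0, e) ε q)
          = L q + ε * A q + ε ^ 2 * B q := fun q hq => by
      have hpos := (hδ ε hε).2 q
      rw [det_id_add_smulRight]
      simp only [smul_apply, smul_eq_mul]
      rw [abs_of_pos hpos, hpull q (hTQ hq)]
    have hsum : IntegrableOn (fun q => L q + ε * A q + ε ^ 2 * B q) T volume :=
      (hLi.add (hAi.const_mul ε)).add (hBi.const_mul (ε ^ 2))
    have hL'i : IntegrableOn L' T volume := by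
      rw [← hTimg, integrableOn_image_iff_integrableOn_abs_det_fderiv_smul volume hTm hder
        hb.1.injOn]
      exact hsum.congr_fun (fun q hq => (hjac q hq).symm) hTm
    have hL'int : ∫ q in T, L' q = ∫ q in T, (L q + ε * A q + ε ^ 2 * B q) := by
      conv_lhs => rw [← hTimg]
      rw [integral_image_eq_integral_abs_det_fderiv_smul volume hTm hder hb.1.injOn]
      exact setIntegral_congr_fun hTm hjac
    have hloc : actionIncrement σ Fr ρref a b 𝒟 D₀ ρ₀ u (u.push e χ ε)
        = ∫ q in T, (L' q - L q) := by
      refine setIntegral_eq_of_subset_of_forall_sdiff_eq_zero hQ.measurableSet hTQ fun q hq => ?_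
      -- Off the support the shear fixes the point with Jacobian 1 and the corrections vanish, so
      -- the pullback identity says that the two densities agree.
      have h1 := hpull q hq.1
      rw [shear_of_eq_zero (image_eq_zero_of_notMem_tsupport hq.2), (h0 q hq.2).2] at h1
      have hA0 : A q = 0 := by simp [hA, h0 q hq.2]
      have hB0 : B q = 0 := by simp [B, h0 q hq.2]
      rw [hA0, hB0] at h1
      have h2 : L' q = L q := by simpa using h1
      exact sub_eq_zero.2 h2
    rw [hloc, integral_sub hL'i hLi, hL'int,
      integral_add (f := fun q => L q + ε * A q) (hLi.add (hAi.const_mul ε))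
        (hBi.const_mul (ε ^ 2)), integral_add hLi (hAi.const_mul ε), integral_const_mul, integral_const_mul]
    ring
  have hAT : ∫ q in T, A q = ∫ q, A q :=
    setIntegral_eq_integral_of_forall_compl_eq_zero fun q hq => by simp [hA, h0 q hq]
  rw [← hAT]
  refine eq_zero_of_hasDerivAt_quadratic (β := ∫ q in T, B q) (hS _ (isVariation_push hu hχ hδ hδpos)) ?_
  filter_upwards [Ioo_mem_nhds (neg_lt_zero.2 hδpos) hδpos] with ε hε using key ε hε

/-- The horizontal momentum equation. -/
theorem HamiltonPrinciple.momentum_equation (e : Plane) :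
    ∀ q ∈ Ioo a b ×ˢ 𝒟, u.density ρ₀ q.1 q.2 *
      inner ℝ (u.flowDeriv (fun q : ℝ × Plane => u.velocity q.1 q.2) q) e
        = -fderiv ℝ (fun q : ℝ × Plane => u.p q.1 q.2) q (0, e) := by
  have hJ : IsOpen (Ioo a b) := isOpen_Ioo
  have hQ := hJ.prod h𝒟
  have hD := hS.areaDensity_eq_one hu h𝒟 hD₀ hρ₀ hρ₀pos
  have hv := hu.contDiffOn_velocity hJ h𝒟
  have hρ := hu.contDiffOn_density hρ₀
  have hve : ContDiffOn ℝ ∞ (fun q : ℝ × Plane => inner ℝ (u.velocity q.1 q.2) e)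
      (Ioo a b ×ˢ 𝒟) := hv.inner ℝ contDiffOn_const
  have hf := hρ.mul hve
  have hfd := hu.contDiffOn_flowDeriv hJ h𝒟 hf
  have hpd : ContDiffOn ℝ ∞ (fun q => fderiv ℝ (fun q : ℝ × Plane => u.p q.1 q.2) q (0, e))
      (Ioo a b ×ˢ 𝒟) := contDiffOn_fderiv_apply hQ hu.smooth_p contDiffOn_const
  have h := eq_zero_of_forall_integral_eq_zero (μ := (volume : Measure (ℝ × Plane)))
    hQ (hfd.add hpd).continuousOn fun χ hχ => by
      have h1 := hS.integral_push_eq_zero hu h𝒟 hD₀ hρ₀ hρ₀pos e hχ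
      have h2 := hu.integral_mul_flowDeriv hJ h𝒟 hD hD₀ hf hχ
      have hχe : IsTest (fun q => fderiv ℝ χ q (0, e)) (Ioo a b ×ˢ 𝒟) :=
        hχ.fderiv_apply hQ contDiffOn_const
      -- The pressure term is integrated by parts along the constant field `(0, e)`; only the
      -- inertial term, along the flow, relies on `D = 1`.
      have h3 := hχ.integral_mul_fderiv_apply (μ := (volume : Measure (ℝ × Plane))) hQ
        (w := fun _ => ((0 : ℝ), e)) contDiffOn_const
        (fun k hk => integral_fderiv_apply_eq_zero (hk.smooth.of_le (by simp)) hk.compact _)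
        hu.smooth_p
      have i1 := (hχ.mul_left hQ hfd).integrable (volume : Measure (ℝ × Plane))
      have i2 := (hχ.mul_left hQ hpd).integrable (volume : Measure (ℝ × Plane))
      have i3 := ((hu.isTest_flowDeriv hJ h𝒟 hχ).mul_left hQ hf).integrable
        (volume : Measure (ℝ × Plane))
      have i4 := (hχe.mul_left hQ hu.smooth_p).integrable (volume : Measure (ℝ × Plane))
      rw [integral_add i3 i4, h2, h3, ← neg_add, neg_eq_zero] at h1
      simp only [add_mul]
      rw [integral_add i1 i2]
      exact h1
  intro q hq
  have d1 := (differentiableAt_of_contDiffOn hQ hv hq).hasFDerivAt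
  have d2 := (differentiableAt_of_contDiffOn hQ hρ hq).hasFDerivAt
  have d3 := d1.inner ℝ (hasFDerivAt_const e q)
  have d4 := hu.flowDeriv_density hJ h𝒟 hρ₀ hq
  have d5 := (d2.mul d3).fderiv
  have h2 : u.flowDeriv (fun q : ℝ × Plane => u.density ρ₀ q.1 q.2
      * inner ℝ (u.velocity q.1 q.2) e) q = u.density ρ₀ q.1 q.2 *
      inner ℝ (u.flowDeriv (fun q : ℝ × Plane => u.velocity q.1 q.2) q) e := by
    have d6 : fderiv ℝ (fun q : ℝ × Plane => u.density ρ₀ q.1 q.2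
      * inner ℝ (u.velocity q.1 q.2) e) q = _ := d5
    simp only [flowDeriv] at d4 ⊢
    rw [d6]
    simp [d4]
  have h1 : u.flowDeriv (fun q : ℝ × Plane => u.density ρ₀ q.1 q.2
      * inner ℝ (u.velocity q.1 q.2) e) q
      + fderiv ℝ (fun q : ℝ × Plane => u.p q.1 q.2) q (0, e) = 0 := h q hq
  rw [← h2]
  exact eq_neg_of_add_eq_zero_left h1

end State

/-! ### Integrals of 1-forms along a fixed loop -/

section LoopIntegrals

theorem continuousOn_slice_clm_apply {G H : Type*} [TopologicalSpace G]
    [NormedAddCommGroup H] [NormedSpace ℝ H]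
    {J : Set ℝ} {𝒟 : Set G} {c : ℝ → G} {Λ : ℝ × G → H →L[ℝ] ℝ} (hΛ : ContinuousOn Λ (J ×ˢ 𝒟)) {h : ℝ → H} {τ : ℝ} (hτ : τ ∈ J)
    (hc : ContinuousOn c (Icc 0 1)) (hc𝒟 : MapsTo c (Icc 0 1) 𝒟)
    (hd : ContinuousOn h (Icc 0 1)) : ContinuousOn (fun s => Λ (τ, c s) (h s)) (Icc 0 1) :=
  (hΛ.comp (continuousOn_const.prodMk hc) fun _ hs => ⟨hτ, hc𝒟 hs⟩).clm_apply hd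

variable {G : Type*} [NormedAddCommGroup G] [NormedSpace ℝ G] {J : Set ℝ} {𝒟 : Set G}
  {c d : ℝ → G}

/-- Differentiation under the integral sign for a time-dependent 1-form along a fixed curve. -/
theorem hasDerivAt_integral_form {Λ : ℝ × G → G →L[ℝ] ℝ} (hJ : IsOpen J) (h𝒟 : IsOpen 𝒟)
    (hΛ : ContDiffOn ℝ ∞ Λ (J ×ˢ 𝒟)) (hc : ContinuousOn c (Icc 0 1))
    (hc𝒟 : MapsTo c (Icc 0 1) 𝒟) (hd : ContinuousOn d (Icc 0 1)) {t : ℝ} (ht : t ∈ J) :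
    HasDerivAt (fun τ => ∫ s in (0 : ℝ)..1, Λ (τ, c s) (d s))
      (∫ s in (0 : ℝ)..1, fderiv ℝ Λ (t, c s) (1, 0) (d s)) t := by
  have hQ := hJ.prod h𝒟
  -- A closed ball inside `J` makes the parameter set compact, so the time derivative of the
  -- integrand is dominated by a constant.
  obtain ⟨r, hr, hrJ⟩ := Metric.nhds_basis_closedBall.mem_iff.1 (hJ.mem_nhds ht)
  have hΛ' : ContinuousOn (fun q => fderiv ℝ Λ q (1, 0)) (J ×ˢ 𝒟) :=
    (contDiffOn_fderiv_apply hQ hΛ contDiffOn_const).continuousOn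
  have hbd : ContinuousOn (fun z : ℝ × ℝ => fderiv ℝ Λ (z.1, c z.2) (1, 0) (d z.2))
      (Metric.closedBall t r ×ˢ Icc 0 1) := by
    refine ContinuousOn.clm_apply (hΛ'.comp (continuousOn_fst.prodMk
      (hc.comp continuousOn_snd fun z hz => hz.2)) fun z hz => ⟨hrJ hz.1, hc𝒟 hz.2⟩)
      (hd.comp continuousOn_snd fun z hz => hz.2)
  obtain ⟨C, hC⟩ := ((isCompact_closedBall t r).prod isCompact_Icc).exists_bound_of_continuousOn hbd
  have hu : uIoc (0 : ℝ) 1 ⊆ Icc 0 1 := by rw [uIoc_of_le zero_le_one]; exact Ioc_subset_Icc_self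
  have hmeas : ∀ {f : ℝ → ℝ}, ContinuousOn f (Icc 0 1) →
      AEStronglyMeasurable f (volume.restrict (uIoc (0 : ℝ) 1)) := fun hf =>
    (hf.aestronglyMeasurable measurableSet_Icc).mono_set hu
  refine (intervalIntegral.hasDerivAt_integral_of_dominated_loc_of_deriv_le
    (F' := fun τ s => fderiv ℝ Λ (τ, c s) (1, 0) (d s)) (bound := fun _ => C)
    (Metric.closedBall_mem_nhds t hr) ?_ ?_ ?_ ?_ ?_ ?_).2
  · filter_upwards [hJ.mem_nhds ht] with τ hτ
    exact hmeas (continuousOn_slice_clm_apply hΛ.continuousOn hτ hc hc𝒟 hd)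
  · exact (continuousOn_slice_clm_apply hΛ.continuousOn ht hc hc𝒟
      hd).intervalIntegrable_of_Icc zero_le_one
  · exact hmeas (continuousOn_slice_clm_apply hΛ' ht hc hc𝒟 hd)
  · exact ae_of_all _ fun s hs τ hτ => hC (τ, s) ⟨hτ, hu hs⟩
  · exact intervalIntegrable_const
  · refine ae_of_all _ fun s hs τ hτ => ?_
    simpa using (hasDerivAt_slice_time (differentiableAt_of_contDiffOn hQ hΛ
      ⟨hrJ hτ, hc𝒟 (hu hs)⟩)).clm_apply (hasDerivAt_const τ (d s))

/-- The integral of a differential along a closed curve vanishes. -/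
theorem integral_fderiv_loop_eq_zero {K : ℝ × G → ℝ} (hJ : IsOpen J) (h𝒟 : IsOpen 𝒟)
    (hK : ContDiffOn ℝ ∞ K (J ×ˢ 𝒟)) (hc : ContDiffOn ℝ 1 c (Icc 0 1))
    (hc𝒟 : MapsTo c (Icc 0 1) 𝒟) (hloop : c 0 = c 1) {t : ℝ} (ht : t ∈ J) :
    IntervalIntegrable (fun s => fderiv ℝ K (t, c s) (0, derivWithin c (Icc 0 1) s)) volume 0 1 ∧
    ∫ s in (0 : ℝ)..1, fderiv ℝ K (t, c s) (0, derivWithin c (Icc 0 1) s) = 0 := by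
  have hQ := hJ.prod h𝒟
  have hd := hc.continuousOn_derivWithin uniqueDiffOn_Icc_zero_one le_rfl
  have hint : IntervalIntegrable (fun s => fderiv ℝ K (t, c s) (0, derivWithin c (Icc 0 1) s))
      volume 0 1 := by
    refine ContinuousOn.intervalIntegrable_of_Icc zero_le_one ?_
    exact continuousOn_slice_clm_apply (hK.continuousOn_fderiv_of_isOpen hQ (by simp)) ht
      hc.continuousOn hc𝒟 (continuousOn_const.prodMk hd)
  refine ⟨hint, ?_⟩
  rw [intervalIntegral.integral_eq_sub_of_hasDerivAt_of_le (f := fun s => K (t, c s))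
    zero_le_one ?_ ?_ hint, hloop, sub_self]
  · exact hK.continuousOn.comp (continuousOn_const.prodMk hc.continuousOn)
      fun s hs => ⟨ht, hc𝒟 hs⟩
  · intro s hs
    have hs' := Ioo_subset_Icc_self hs
    have h1 := ((hc.differentiableOn (by simp)) s hs').hasDerivWithinAt.hasDerivAt
      (Icc_mem_nhds hs.1 hs.2)
    exact (differentiableAt_of_contDiffOn hQ hK ⟨ht, hc𝒟 hs'⟩).hasFDerivAt.comp_hasDerivAt s
      ((hasDerivAt_const s t).prodMk h1)

/-- This is what exchanges the time derivative with label derivatives of `φ` and of `ζ ∘ φ`. -/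
theorem fderiv_fderiv_apply_comm {E F : Type*} [NormedAddCommGroup E] [NormedSpace ℝ E]
    [NormedAddCommGroup F] [NormedSpace ℝ F] {f : E → F} {Q : Set E} (hQ : IsOpen Q)
    (hf : ContDiffOn ℝ ∞ f Q) {q : E} (hq : q ∈ Q) (v w : E) :
    fderiv ℝ (fun p => fderiv ℝ f p v) q w = fderiv ℝ (fun p => fderiv ℝ f p w) q v := by
  have h1 : DifferentiableAt ℝ (fderiv ℝ f) q :=
    differentiableAt_of_contDiffOn hQ (hf.fderiv_of_isOpen hQ (by simp)) hq
  have h2 : ∀ v, fderiv ℝ (fun p => fderiv ℝ f p v) q = (fderiv ℝ (fderiv ℝ f) q).flip v :=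
    fun v => (h1.hasFDerivAt.clm_apply (hasFDerivAt_const v q)).fderiv.trans (by simp)
  rw [h2, h2]
  exact ((hf.contDiffAt (hQ.mem_nhds hq)).isSymmSndFDerivAt (by
    rw [minSmoothness_of_isRCLikeNormedField]; exact WithTop.coe_le_coe.2 (le_top : (2 : ℕ∞) ≤ ⊤))).eq w v

end LoopIntegrals

/-! ### The momentum 1-form in label coordinates -/

namespace State

variable {u : State} {J : Set ℝ} {𝒟 : Set Plane}

/-- The momentum 1-form pulled back to the labels. -/
noncomputable def labelMomentumForm (u : State) (σ : ℝ) (q : ℝ × Plane) : Plane →L[ℝ] ℝ :=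
  (innerSL ℝ (u.labelVelocity q)).comp
      ((fderiv ℝ (fun q : ℝ × Plane => u.φ q.1 q.2) q).comp (.inr ℝ ℝ Plane))
    + (σ ^ 2 * fderiv ℝ (fun q => u.ζ q.1 (u.φ q.1 q.2)) q (1, 0)) •
      (fderiv ℝ (fun q : ℝ × Plane => u.ζ q.1 (u.φ q.1 q.2)) q).comp (.inr ℝ ℝ Plane)

/-- The kinetic energy per unit mass, as a function of time and label. -/
noncomputable def labelKineticEnergy (u : State) (σ : ℝ) (q : ℝ × Plane) : ℝ :=
  1 / 2 * (inner ℝ (u.labelVelocity q) (u.labelVelocity q)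
    + σ ^ 2 * fderiv ℝ (fun q => u.ζ q.1 (u.φ q.1 q.2)) q (1, 0) ^ 2)

/-- The integral of a 1-form along a material loop, pulled back to the labels. -/
theorem IsMaterialLoop.curveIntegral_eq {y : Plane} {c : Path y y} {r : ℝ → Plane}
    {γ : ∀ t, Path (r t) (r t)} (hγ : u.IsMaterialLoop J c γ) (hu : u.IsSmoothOn J 𝒟)
    (hJ : IsOpen J) (h𝒟 : IsOpen 𝒟) (hc𝒟 : ∀ s, c s ∈ 𝒟)
    (hc : ContDiffOn ℝ 1 c.extend (Icc 0 1)) (η : Plane → Plane →L[ℝ] ℝ) {τ : ℝ} (hτ : τ ∈ J) :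
    ∫ᶜ x in γ τ, η x = ∫ s in (0 : ℝ)..1, η (u.φ τ (c.extend s))
      (fderiv ℝ (fun q : ℝ × Plane => u.φ q.1 q.2) (τ, c.extend s)
        (0, derivWithin c.extend (Icc 0 1) s)) := by
  rw [curveIntegral_def]
  refine intervalIntegral.integral_congr fun s hs => ?_
  rw [uIcc_of_le zero_le_one] at hs
  have heq : ∀ s ∈ Icc (0 : ℝ) 1, (γ τ).extend s = u.φ τ (c.extend s) := fun s hs => by
    rw [Path.extend_apply _ hs, Path.extend_apply _ hs, hγ τ hτ]
  have hmem : c.extend s ∈ 𝒟 := by rw [Path.extend_apply _ hs]; exact hc𝒟 _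
  have h1 := (hc.differentiableOn (by simp) s hs).hasDerivWithinAt
  have h2 := (hu.hasFDerivAt_φ hJ h𝒟 (q := (τ, c.extend s)) ⟨hτ, hmem⟩).comp_hasDerivWithinAt s h1
  rw [curveIntegralFun_def, derivWithin_congr heq (heq s hs), heq s hs]
  exact congrArg (η (u.φ τ (c.extend s))) (h2.derivWithin (uniqueDiffOn_Icc_zero_one s hs))

section

variable (hu : u.IsSmoothOn J 𝒟) (hJ : IsOpen J) (h𝒟 : IsOpen 𝒟)
include hu hJ h𝒟

omit hJ h𝒟 in
theorem IsSmoothOn.contDiffOn_ζ_comp_φ :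
    ContDiffOn ℝ ∞ (fun q : ℝ × Plane => u.ζ q.1 (u.φ q.1 q.2)) (J ×ˢ 𝒟) :=
  hu.smooth_ζ.comp hu.contDiffOn_toPos hu.mapsTo_toPos

theorem IsSmoothOn.contDiffOn_labelMomentumForm (σ : ℝ) :
    ContDiffOn ℝ ∞ (u.labelMomentumForm σ) (J ×ˢ 𝒟) := by
  have hQ := hJ.prod h𝒟
  have h1 := hu.smooth_φ.fderiv_of_isOpen (m := ∞) hQ (by simp)
  have h2 := hu.contDiffOn_ζ_comp_φ.fderiv_of_isOpen (m := ∞) hQ (by simp)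
  have h3 := contDiffOn_fderiv_apply hQ hu.contDiffOn_ζ_comp_φ
    (contDiffOn_const (c := ((1 : ℝ), (0 : Plane))))
  have h4 := hu.contDiffOn_labelVelocity hJ h𝒟
  have h5 : ContDiffOn ℝ ∞ (fun q => innerSL ℝ (u.labelVelocity q)) (J ×ˢ 𝒟) :=
    (innerSL ℝ : Plane →L[ℝ] Plane →L[ℝ] ℝ).contDiff.comp_contDiffOn h4
  exact (h5.clm_comp (h1.clm_comp contDiffOn_const)).add
    ((contDiffOn_const.mul h3).smul (h2.clm_comp contDiffOn_const))

theorem IsSmoothOn.contDiffOn_labelKineticEnergy (σ : ℝ) :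
    ContDiffOn ℝ ∞ (u.labelKineticEnergy σ) (J ×ˢ 𝒟) := by
  have h3 := contDiffOn_fderiv_apply (hJ.prod h𝒟) hu.contDiffOn_ζ_comp_φ
    (contDiffOn_const (c := ((1 : ℝ), (0 : Plane))))
  have h4 := hu.contDiffOn_labelVelocity hJ h𝒟
  exact contDiffOn_const.mul ((h4.inner ℝ h4).add (contDiffOn_const.mul (h3.pow 2)))

variable {q : ℝ × Plane} (hq : q ∈ J ×ˢ 𝒟)
include hq

theorem IsSmoothOn.fderiv_comp_toPos_space {F : Type*} [NormedAddCommGroup F] [NormedSpace ℝ F]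
    {f : ℝ × Plane → F} (hf : DifferentiableAt ℝ f (u.toPos q)) (y : Plane) :
    fderiv ℝ (fun p => f (u.toPos p)) q (0, y) = fderiv ℝ f (u.toPos q)
      (0, fderiv ℝ (fun q : ℝ × Plane => u.φ q.1 q.2) q (0, y)) := by
  have h1 := hf.hasFDerivAt.comp q (hu.hasFDerivAt_toPos hJ h𝒟 hq)
  have h2 : HasFDerivAt (fun p => f (u.toPos p)) _ q := h1
  rw [h2.fderiv]
  rfl

theorem IsSmoothOn.fderiv_ζ_comp_φ :
    fderiv ℝ (fun q : ℝ × Plane => u.ζ q.1 (u.φ q.1 q.2)) q (1, 0)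
      = u.verticalVelocity q.1 (u.φ q.1 q.2) := by
  have hq' := hu.mapsTo_toPos hq
  have h1 := hu.fderiv_comp_toPos hJ h𝒟 hq
    (differentiableAt_of_contDiffOn (hJ.prod h𝒟) hu.smooth_ζ hq')
  exact h1.trans (hu.verticalVelocity_eq hJ h𝒟 hq').symm

theorem IsSmoothOn.momentumForm_comp_fderiv_φ (σ : ℝ) (y : Plane) :
    u.momentumForm σ q.1 (u.φ q.1 q.2) (fderiv ℝ (fun q : ℝ × Plane => u.φ q.1 q.2) q (0, y))
      = u.labelMomentumForm σ q y := by
  have hd := differentiableAt_of_contDiffOn (hJ.prod h𝒟) hu.smooth_ζ (hu.mapsTo_toPos hq)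
  have h1 := hu.fderiv_comp_toPos_space hJ h𝒟 hq hd y
  have h2 := (hasFDerivAt_slice_space (t := q.1) (x := u.φ q.1 q.2) hd).fderiv
  have h3 : fderiv ℝ (u.ζ q.1) (u.φ q.1 q.2) = _ := h2
  have h4 : fderiv ℝ (fun q : ℝ × Plane => u.ζ q.1 (u.φ q.1 q.2)) q (0, y) = _ := h1
  simp only [momentumForm, labelMomentumForm, hu.fderiv_ζ_comp_φ hJ h𝒟 hq,
    hu.velocity_toPos hJ h𝒟 hq, h3, add_apply,
    smul_apply, ContinuousLinearMap.comp_apply,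
    ContinuousLinearMap.inr_apply, h4]
  rfl

/-- The rate of change of the momentum 1-form at a fixed label. -/
theorem IsSmoothOn.fderiv_labelMomentumForm (σ : ℝ) (y : Plane) :
    fderiv ℝ (u.labelMomentumForm σ) q (1, 0) y
      = inner ℝ (u.flowDeriv (fun q : ℝ × Plane => u.velocity q.1 q.2) (u.toPos q))
          (fderiv ℝ (fun q : ℝ × Plane => u.φ q.1 q.2) q (0, y))
        + σ ^ 2 * u.flowDeriv (fun q : ℝ × Plane => u.verticalVelocity q.1 q.2) (u.toPos q)
          * fderiv ℝ (fun q : ℝ × Plane => u.ζ q.1 q.2) (u.toPos q)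
            (0, fderiv ℝ (fun q : ℝ × Plane => u.φ q.1 q.2) q (0, y))
        + fderiv ℝ (u.labelKineticEnergy σ) q (0, y) := by
  have hQ := hJ.prod h𝒟
  have hq' := hu.mapsTo_toPos hq
  let Z : ℝ × Plane → ℝ := fun q => u.ζ q.1 (u.φ q.1 q.2)
  have hZ : ContDiffOn ℝ ∞ Z (J ×ˢ 𝒟) := hu.contDiffOn_ζ_comp_φ
  let W : ℝ × Plane → ℝ := fun q => fderiv ℝ Z q (1, 0)
  have hW : ContDiffOn ℝ ∞ W (J ×ˢ 𝒟) := contDiffOn_fderiv_apply hQ hZ contDiffOn_const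
  have hV := hu.contDiffOn_labelVelocity hJ h𝒟
  have dV := (differentiableAt_of_contDiffOn hQ hV hq).hasFDerivAt
  have dW := (differentiableAt_of_contDiffOn hQ hW hq).hasFDerivAt
  have dφ := (differentiableAt_of_contDiffOn hQ (contDiffOn_fderiv_apply hQ hu.smooth_φ
    (contDiffOn_const (c := ((0 : ℝ), y)))) hq).hasFDerivAt
  have dZ := (differentiableAt_of_contDiffOn hQ (contDiffOn_fderiv_apply hQ hZ
    (contDiffOn_const (c := ((0 : ℝ), y)))) hq).hasFDerivAt
  have dΛ := (differentiableAt_of_contDiffOn hQ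
    (hu.contDiffOn_labelMomentumForm hJ h𝒟 σ) hq).hasFDerivAt
  -- The mixed derivatives of `φ` and `Z` in time and along `y` are the label derivatives of the
  -- velocities `V` and `W`. The terms `V·∂V + σ²W∂W` arising from them are the differential of the
  -- kinetic energy.
  have s1 := fderiv_fderiv_apply_comm hQ hu.smooth_φ hq ((0 : ℝ), y) ((1 : ℝ), (0 : Plane))
  have s2 := fderiv_fderiv_apply_comm hQ hZ hq ((0 : ℝ), y) ((1 : ℝ), (0 : Plane))
  have eV : fderiv ℝ u.labelVelocity q (1, 0)
      = u.flowDeriv (fun q : ℝ × Plane => u.velocity q.1 q.2) (u.toPos q) := by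
    rw [← hu.fderiv_comp_toPos hJ h𝒟 hq
      (differentiableAt_of_contDiffOn hQ (hu.contDiffOn_velocity hJ h𝒟) hq')]
    congr 1
    refine Filter.EventuallyEq.fderiv_eq ?_
    filter_upwards [hQ.mem_nhds hq] with p hp using (hu.velocity_toPos hJ h𝒟 hp).symm
  have eW : fderiv ℝ W q (1, 0)
      = u.flowDeriv (fun q : ℝ × Plane => u.verticalVelocity q.1 q.2) (u.toPos q) := by
    rw [← hu.fderiv_comp_toPos hJ h𝒟 hq
      (differentiableAt_of_contDiffOn hQ (hu.contDiffOn_verticalVelocity hJ h𝒟) hq')]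
    congr 1
    refine Filter.EventuallyEq.fderiv_eq ?_
    filter_upwards [hQ.mem_nhds hq] with p hp using hu.fderiv_ζ_comp_φ hJ h𝒟 hp
  have eZ : fderiv ℝ Z q (0, y) = fderiv ℝ (fun q : ℝ × Plane => u.ζ q.1 q.2) (u.toPos q)
      (0, fderiv ℝ (fun q : ℝ × Plane => u.φ q.1 q.2) q (0, y)) :=
    hu.fderiv_comp_toPos_space hJ h𝒟 hq (differentiableAt_of_contDiffOn hQ hu.smooth_ζ hq') y
  have k1 : HasFDerivAt (fun p => u.labelMomentumForm σ p y) _ q :=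
    dΛ.clm_apply (hasFDerivAt_const y q)
  -- The evaluated form is differentiated a second time from its explicit expression; uniqueness of
  -- the derivative equates the two results.
  have k2 : HasFDerivAt (fun p => u.labelMomentumForm σ p y) _ q :=
    (dV.inner ℝ dφ).add ((dW.const_mul (σ ^ 2)).mul dZ)
  have k3 : HasFDerivAt (u.labelKineticEnergy σ) _ q :=
    ((dV.inner ℝ dV).add ((dW.pow 2).const_mul (σ ^ 2))).const_mul (1 / 2)
  have k4 := congrArg (fun f : ℝ × Plane →L[ℝ] ℝ => f (1, 0)) (k1.unique k2)
  have k5 := congrArg (fun f : ℝ × Plane →L[ℝ] ℝ => f (0, y)) k3.fderiv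
  have s1' : fderiv ℝ (fun p => fderiv ℝ (fun q : ℝ × Plane => u.φ q.1 q.2) p (0, y)) q (1, 0)
    = fderiv ℝ u.labelVelocity q (0, y) := s1
  have s2' : fderiv ℝ (fun p => fderiv ℝ Z p (0, y)) q (1, 0) = fderiv ℝ W q (0, y) := s2
  rw [← eV, ← eW, ← eZ]
  simp [fderivInnerCLM_apply, s1', s2'] at k4 k5
  rw [k4, k5, real_inner_comm (fderiv ℝ u.labelVelocity q (0, y))]
  ring

end

end State

/-! ### Material wave equation and circulation theorem -/

namespace State

variable {u : State} {𝒟 : Set Plane} {σ Fr ρref a b : ℝ} {D₀ ρ₀ : Plane → ℝ}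
  (hS : u.HamiltonPrinciple σ Fr ρref a b 𝒟 D₀ ρ₀)
  (hu : u.IsSmoothOn (Ioo a b) 𝒟) (h𝒟 : IsOpen 𝒟) (hD₀ : ContDiffOn ℝ ∞ D₀ 𝒟)
  (hρ₀ : ContDiffOn ℝ ∞ ρ₀ 𝒟) (hρ₀pos : ∀ y ∈ 𝒟, 0 < ρ₀ y)
include hS hu h𝒟 hD₀ hρ₀ hρ₀pos

theorem HamiltonPrinciple.materialDeriv_verticalVelocity (hσ : σ ≠ 0) (hFr : Fr ≠ 0)
    {q : ℝ × Plane} (hq : q ∈ Ioo a b ×ˢ 𝒟) :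
    u.materialDeriv u.verticalVelocity q.1 q.2
      = -(ρref / (σ ^ 2 * Fr ^ 2 * u.density ρ₀ q.1 q.2)) * u.ζ q.1 q.2 := by
  have hJ : IsOpen (Ioo a b) := isOpen_Ioo
  have h1 := hS.elevation_equation hu h𝒟 hD₀ hρ₀ hρ₀pos q hq
  have hρ : u.density ρ₀ q.1 q.2 ≠ 0 := (hρ₀pos _ (hu.mapsTo_toLabel hq).2).ne'
  rw [materialDeriv_eq (differentiableAt_of_contDiffOn (hJ.prod h𝒟)
    (hu.contDiffOn_verticalVelocity hJ h𝒟) hq)]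
  apply mul_left_cancel₀ (mul_ne_zero (pow_ne_zero 2 hσ) hρ)
  rw [h1]
  field_simp

/-- The pressure 1-form pulled back to the labels. -/
theorem HamiltonPrinciple.pressureForm_comp_fderiv_φ {q : ℝ × Plane}
    (hq : q ∈ Ioo a b ×ˢ 𝒟) (y : Plane) :
    u.pressureForm Fr ρref ρ₀ q.1 (u.φ q.1 q.2)
        (fderiv ℝ (fun q : ℝ × Plane => u.φ q.1 q.2) q (0, y))
      = fderiv ℝ (u.labelKineticEnergy σ) q (0, y)
        - fderiv ℝ (u.labelMomentumForm σ) q (1, 0) y := by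
  have hJ : IsOpen (Ioo a b) := isOpen_Ioo
  have hQ := hJ.prod h𝒟
  have hq' := hu.mapsTo_toPos hq
  have h1 := hS.elevation_equation hu h𝒟 hD₀ hρ₀ hρ₀pos _ hq'
  set e := fderiv ℝ (fun q : ℝ × Plane => u.φ q.1 q.2) q (0, y) with he
  have h2 := hS.momentum_equation hu h𝒟 hD₀ hρ₀ hρ₀pos e _ hq'
  rw [hu.fderiv_labelMomentumForm hJ h𝒟 hq σ y, ← he]
  have dζ := differentiableAt_of_contDiffOn hQ hu.smooth_ζ hq'
  have dp := differentiableAt_of_contDiffOn hQ hu.smooth_p hq'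
  have dm : HasFDerivAt (fun q : ℝ × Plane => u.modifiedPressure Fr ρref q.1 q.2) _ (u.toPos q) :=
    dp.hasFDerivAt.add (((dζ.hasFDerivAt.pow 2).const_mul ρref).mul_const (1 / (2 * Fr ^ 2)))
      |>.congr_of_eventuallyEq (.of_eq <| by
        funext p; simp [modifiedPressure, div_eq_mul_inv])
  have h3 := (hasFDerivAt_slice_space (t := q.1) (x := u.φ q.1 q.2) dm.differentiableAt).fderiv
  have h4 : fderiv ℝ (u.modifiedPressure Fr ρref q.1) (u.φ q.1 q.2) e
      = fderiv ℝ (fun q : ℝ × Plane => u.p q.1 q.2) (u.toPos q) (0, e)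
        + ρref * u.ζ q.1 (u.φ q.1 q.2)
          * fderiv ℝ (fun q : ℝ × Plane => u.ζ q.1 q.2) (u.toPos q) (0, e) / Fr ^ 2 := by
    have h5 := congrArg (fun f : Plane →L[ℝ] ℝ => f e) h3
    refine h5.trans ?_
    have h6 : fderiv ℝ (fun q : ℝ × Plane => u.modifiedPressure Fr ρref q.1 q.2)
      (q.1, u.φ q.1 q.2) = _ := dm.fderiv
    simp only [ContinuousLinearMap.comp_apply, ContinuousLinearMap.inr_apply, h6]
    simp [toPos]
    ring
  have hρ : u.density ρ₀ (u.toPos q).1 (u.toPos q).2 ≠ 0 :=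
    (hρ₀pos _ (hu.mapsTo_toLabel hq').2).ne'
  simp only [pressureForm, smul_apply, smul_eq_mul, h4]
  simp only [toPos] at h1 h2 hρ ⊢
  apply mul_left_cancel₀ hρ
  rw [← mul_assoc, mul_one_div_cancel hρ, one_mul]
  set ζ' := fderiv ℝ (fun q : ℝ × Plane => u.ζ q.1 q.2) (q.1, u.φ q.1 q.2) (0, e)
  -- The kinetic energy cancels. The momentum equation in the direction `e` supplies `dp`, and the
  -- elevation equation times `dζ(e)` supplies the buoyancy part of `dp̃`.
  linear_combination h2 + ζ' * h1

/-- The Kelvin–Noether circulation theorem. -/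
theorem HamiltonPrinciple.hasDerivAt_circulation {y : Plane} {c : Path y y}
    (hc𝒟 : ∀ s, c s ∈ 𝒟) (hc : ContDiffOn ℝ 1 c.extend (Icc 0 1)) {r : ℝ → Plane}
    {γ : ∀ t, Path (r t) (r t)} (hγ : u.IsMaterialLoop (Ioo a b) c γ) {t : ℝ}
    (ht : t ∈ Ioo a b) :
    HasDerivAt (fun τ => ∫ᶜ x in γ τ, u.momentumForm σ τ x)
      (-∫ᶜ x in γ t, u.pressureForm Fr ρref ρ₀ t x) t := by
  have hJ : IsOpen (Ioo a b) := isOpen_Ioo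
  have hQ := hJ.prod h𝒟
  have hm : MapsTo c.extend (Icc 0 1) 𝒟 := fun s hs => by
    rw [Path.extend_apply _ hs]; exact hc𝒟 _
  have hΛ := hu.contDiffOn_labelMomentumForm hJ h𝒟 σ
  have hd := hc.continuousOn_derivWithin uniqueDiffOn_Icc_zero_one le_rfl
  have h1 := hasDerivAt_integral_form hJ h𝒟 hΛ hc.continuousOn hm hd ht
  obtain ⟨hKi, hK0⟩ := integral_fderiv_loop_eq_zero hJ h𝒟
    (hu.contDiffOn_labelKineticEnergy hJ h𝒟 σ) hc hm (by simp) ht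
  have hΛi : IntervalIntegrable (fun s => fderiv ℝ (u.labelMomentumForm σ) (t, c.extend s) (1, 0)
      (derivWithin c.extend (Icc 0 1) s)) volume 0 1 :=
    (continuousOn_slice_clm_apply (contDiffOn_fderiv_apply hQ hΛ contDiffOn_const).continuousOn ht
      hc.continuousOn hm hd).intervalIntegrable_of_Icc zero_le_one
  have hval : -∫ᶜ x in γ t, u.pressureForm Fr ρref ρ₀ t x
      = ∫ s in (0 : ℝ)..1, fderiv ℝ (u.labelMomentumForm σ) (t, c.extend s) (1, 0)
        (derivWithin c.extend (Icc 0 1) s) := by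
    -- The exact kinetic energy term drops out around the loop, leaving only the rate of change of
    -- the momentum form.
    have hsub := intervalIntegral.integral_sub hKi hΛi
    rw [hK0, zero_sub] at hsub
    rw [hγ.curveIntegral_eq hu hJ h𝒟 hc𝒟 hc _ ht, neg_eq_iff_eq_neg, ← hsub]
    refine intervalIntegral.integral_congr fun s hs => ?_
    rw [uIcc_of_le zero_le_one] at hs
    exact hS.pressureForm_comp_fderiv_φ hu h𝒟 hD₀ hρ₀ hρ₀pos
      (q := (t, c.extend s)) ⟨ht, hm hs⟩ _
  rw [hval]
  refine h1.congr_of_eventuallyEq ?_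
  filter_upwards [hJ.mem_nhds ht] with τ hτ
  rw [hγ.curveIntegral_eq hu hJ h𝒟 hc𝒟 hc _ hτ]
  refine intervalIntegral.integral_congr fun s hs => ?_
  rw [uIcc_of_le zero_le_one] at hs
  exact hu.momentumForm_comp_fderiv_φ hJ h𝒟 (q := (τ, c.extend s)) ⟨hτ, hm hs⟩ σ _

end State

end WaveCurrent

theorem mainTheorem1 (σ Fr ρref a b : ℝ) (hσ : 0 < σ) (hFr : 0 < Fr) (hρref : 0 < ρref)
    (𝒟 : Set WaveCurrent.Plane) (h𝒟 : IsOpen 𝒟)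
    (D₀ ρ₀ : WaveCurrent.Plane → ℝ)
    (hD₀ : ContDiffOn ℝ ∞ D₀ 𝒟) (hρ₀ : ContDiffOn ℝ ∞ ρ₀ 𝒟) (hρ₀pos : ∀ y ∈ 𝒟, 0 < ρ₀ y)
    (u : WaveCurrent.State) (hu : u.IsSmoothOn (Ioo a b) 𝒟)
    (hS : u.HamiltonPrinciple σ Fr ρref a b 𝒟 D₀ ρ₀) :
    (∀ (y : WaveCurrent.Plane) (c : Path y y), (∀ s, c s ∈ 𝒟) →
      ContDiffOn ℝ 1 c.extend (Icc 0 1) →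
      ∀ (r : ℝ → WaveCurrent.Plane) (γ : ∀ t, Path (r t) (r t)),
        u.IsMaterialLoop (Ioo a b) c γ →
        ∀ t ∈ Ioo a b,
          HasDerivAt (fun τ => ∫ᶜ x in γ τ, u.momentumForm σ τ x)
            (-∫ᶜ x in γ t, u.pressureForm Fr ρref ρ₀ t x) t) ∧
    (∀ t ∈ Ioo a b, ∀ x ∈ 𝒟,
      u.materialDeriv u.verticalVelocity t x
        = -(ρref / (σ ^ 2 * Fr ^ 2 * u.density ρ₀ t x)) * u.ζ t x ∧
      u.materialDeriv u.ζ t x = u.verticalVelocity t x) := by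
  refine ⟨fun y c hc𝒟 hc r γ hγ t ht =>
    hS.hasDerivAt_circulation hu h𝒟 hD₀ hρ₀ hρ₀pos hc𝒟 hc hγ ht, fun t ht x hx => ⟨?_, ?_⟩⟩
  · exact hS.materialDeriv_verticalVelocity hu h𝒟 hD₀ hρ₀ hρ₀pos hσ.ne' hFr.ne' (q := (t, x))
      ⟨ht, hx⟩
  · exact hu.materialDeriv_ζ isOpen_Ioo h𝒟 (q := (t, x)) ⟨ht, hx⟩
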